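/- **System.** Let $A$ be a finite set of modes, $F(a)\in\mathbb R^{m\times m}$, $G(a)\in\mathbb R^{m\times r}$ for $a\in A$, and let $\mathrm{Cov}_w\in\mathbb R^{r\times r}$ be a covariance matrix such that $G(a)\,\mathrm{Cov}_w\,G(a)^T$ is positive definite for every $a$. Let $T(\cdot\mid x,a)$ be the law of $F(a)x+G(a)w$ with $w\sim\mathcal N(0,\mathrm{Cov}_w)$. A (measurable) switching strategy maps each finite path $s_0\dots s_k$ of hybrid states $s_i=(a_i,x_i)\in A\times\mathbb R^m$ to a mode $a$; then $s_{k+1}=(a,x_{k+1})$ with $x_{k+1}\sim T(\cdot\mid x_k,a)$. Let $X\subset\mathbb R^m$ be compact and let $r_1,\dots,r_n\subseteq X$ be closed regions, with atomic propositions $\Upsilon=\{p_1,\dots,p_n\}$; a state $(a,x)$ has the label $\{p_i: x\in r_i\}$. **Specification.** Let $\phi$ be a co-safe LTL formula (built from $p,\neg p,\vee,\wedge,\mathcal X,\mathcal U,\mathcal F$) or a bounded LTL formula (built from $p,\neg,\vee,\mathcal X,\mathcal U^{\le k},\mathcal F^{\le k},\mathcal G^{\le k}$) over $\Upsilon$.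 A finite trace over $2^\Upsilon$ is a good prefix of $\phi$ if all its infinite extensions satisfy $\phi$. Let $P(\phi\mid s_0,X,\sigma)$ be the probability, under the strategy $\sigma$ from $s_0$, that some finite prefix of the path stays in $A\times X$ and its trace is a good prefix of $\phi$. Put $r_{n+i}=X\setminus r_i$, let $p_{n+i}$ be new propositions, $\bar\Upsilon=\{p_1,\dots,p_{2n}\}$, and let $\bar\phi$ be obtained from $\phi$ by pushing negations to the atoms and replacing $\neg p_i$ by $p_{n+i}$. Let $\mathcal A=(Z,2^{\bar\Upsilon},\tau,z_0,Z_{ac})$ be a deterministic finite automaton that accepts exactly the words $w$ over $2^{\bar\Upsilon}$ such that $w\xi$ satisfies $\bar\phi$ for every infinite trace $\xi$ over $2^{\Upsilon}$ (read over $2^{\bar\Upsilon}$ by adding $p_{n+i}$ wherever $p_i$ is absent). **Abstraction.** For each mode $a$ let $X$ be the union of a finite set $Q^a$ of full-dimensional convex polytopes (cells) that pairwise overlap only in Lebesgue null sets; the cells need not respect the regions $r_i$. Let $Q=\bigcup_aQ^a\cup\{q_u\}$, where $q_u$ stands for the complement of $A\times X$. For a cell $q$, an action $a\in A$ and $q'\in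 Q^a$ the interval of transition probabilities is $[\min_{x\in q}T(q'\mid x,a),\max_{x\in q}T(q'\mid x,a)]$; it is $[1-\max_{x\in q}T(X\mid x,a),\,1-\min_{x\in q}T(X\mid x,a)]$ for $q'=q_u$ and $\{0\}$ for cells of other modes; $q_u$ is absorbing. Let $\Gamma_q^a$ be the set of probability distributions on $Q$ within these intervals. For $1\le i\le 2n$ and a cell $q$ define the under-approximating labelling by $p_i\in L(q)\iff q\subseteq r_i$ and the over-approximating labelling by $p_i\in L'(q)\iff q\cap r_i\ne\emptyset$; $L(q_u)=L'(q_u)=\emptyset$. **Bellman values.** On $Q\times Z$ let $\check p$ be the limit of the recursive evaluations, started from the indicator function of $Q\times Z_{ac}$, of $$\check p(q,z)=1\ \text{ if } z\in Z_{ac},\qquad \check p(q,z)=\max_{a\in A}\min_{\gamma\in\Gamma_q^a}\sum_{q'\in Q}\gamma(q')\,\check p\big(q',\tau(z,L(q'))\big)\ \text{ otherwise.}$$ Let $\sigma^*:Q\times Z\to A$ be an optimal stationary strategy, that is, the recursive evaluations with $a=\sigma^*(q,z)$ in place of the maximum have the same limit $\check p$. On $Q\times Z\times Z$ let $\hat p$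 be the limit of the recursive evaluations, started from the indicator function of $\{z'\in Z_{ac}\}$, of $$\hat p(q,z,z')=1\ \text{ if } z'\in Z_{ac},\qquad \hat p(q,z,z')=\max_{\gamma\in\Gamma_q^{\sigma^*(q,z)}}\sum_{q'\in Q}\gamma(q')\,\hat p\big(q',\tau(z,L(q')),\tau(z',L'(q'))\big)\ \text{ otherwise;}$$ this is the upper Bellman value for the labelling $L'$ under $\sigma^*$, where $z$ is the memory of $\sigma^*$. Assign measurably to each $(a,x)$ with $x\in X$ a cell of $Q^a$ that contains $x$, and $q_u$ to the other states. Refine $\sigma^*$ to the switching strategy that on $s_0\dots s_k$, with assigned abstract states $q_0\dots q_k$, chooses the mode $\sigma^*(q_k,z)$, where $z$ is the state of $\mathcal A$ after reading $L(q_0)\dots L(q_k)$; call it $\sigma^*$ again. **Claim.** For every $s_0\in A\times X$, with assigned cell $q$, $$\check p\big(q,\tau(z_0,L(q))\big)\ \le\ P(\phi\mid s_0,X,\sigma^*)\ \le\ \hat p\big(q,\tau(z_0,L(q)),\tau(z_0,L'(q))\big).$$ -/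

import Mathlib

open MeasureTheory ProbabilityTheory

/-! ## Temporal logic -/

/-- The trace `w` followed by the infinite trace `ξ`. -/
def appendTrace {α : Type*} (w : List α) (ξ : ℕ → α) (n : ℕ) : α :=
  if h : n < w.length then w[n] else ξ (n - w.length)

/-- The `k`-th suffix of an infinite trace. -/
def traceSuffix {α : Type*} (ξ : ℕ → α) (k : ℕ) : ℕ → α := fun i => ξ (k + i)

/-- Syntax of co-safe linear temporal logic. -/
inductive CsLTL (Υ : Type*) where
  | atom (p : Υ)
  | negAtom (p : Υ)
  | or (φ ψ : CsLTL Υ)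
  | and (φ ψ : CsLTL Υ)
  | next (φ : CsLTL Υ)
  | untl (φ ψ : CsLTL Υ)
  | ev (φ : CsLTL Υ)

/-- Syntax of bounded linear temporal logic. -/
inductive BLTL (Υ : Type*) where
  | atom (p : Υ)
  | neg (φ : BLTL Υ)
  | or (φ ψ : BLTL Υ)
  | next (φ : BLTL Υ)
  | untlLe (k : ℕ) (φ ψ : BLTL Υ)
  | evLe (k : ℕ) (φ : BLTL Υ)
  | alwLe (k : ℕ) (φ : BLTL Υ)

/-- Negation-free formulas: the target of the translation that turns negated atomic propositions
into atomic propositions of their own. -/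
inductive PosLTL (α : Type*) where
  | atom (p : α)
  | or (φ ψ : PosLTL α)
  | and (φ ψ : PosLTL α)
  | next (φ : PosLTL α)
  | untl (φ ψ : PosLTL α)
  | ev (φ : PosLTL α)
  | untlLe (k : ℕ) (φ ψ : PosLTL α)
  | evLe (k : ℕ) (φ : PosLTL α)
  | alwLe (k : ℕ) (φ : PosLTL α)

/-- Satisfaction of a co-safe formula by an infinite trace. -/
def CsLTL.Sat {Υ : Type*} : CsLTL Υ → (ℕ → Set Υ) → Prop
  | .atom p, ξ => p ∈ ξ 0
  | .negAtom p, ξ => p ∉ ξ 0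
  | .or φ ψ, ξ => φ.Sat ξ ∨ ψ.Sat ξ
  | .and φ ψ, ξ => φ.Sat ξ ∧ ψ.Sat ξ
  | .next φ, ξ => φ.Sat (traceSuffix ξ 1)
  | .untl φ ψ, ξ => ∃ k, ψ.Sat (traceSuffix ξ k) ∧ ∀ i < k, φ.Sat (traceSuffix ξ i)
  | .ev φ, ξ => ∃ k, φ.Sat (traceSuffix ξ k)

/-- Satisfaction of a bounded formula by an infinite trace. -/
def BLTL.Sat {Υ : Type*} : BLTL Υ → (ℕ → Set Υ) → Prop
  | .atom p, ξ => p ∈ ξ 0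
  | .neg φ, ξ => ¬ φ.Sat ξ
  | .or φ ψ, ξ => φ.Sat ξ ∨ ψ.Sat ξ
  | .next φ, ξ => φ.Sat (traceSuffix ξ 1)
  | .untlLe k φ ψ, ξ =>
      ∃ j ≤ k, ψ.Sat (traceSuffix ξ j) ∧ ∀ i < j, φ.Sat (traceSuffix ξ i)
  | .evLe k φ, ξ => ∃ j ≤ k, φ.Sat (traceSuffix ξ j)
  | .alwLe k φ, ξ => ∀ j ≤ k, φ.Sat (traceSuffix ξ j)

/-- Satisfaction of a negation-free formula by an infinite trace. -/
def PosLTL.Sat {α : Type*} : PosLTL α → (ℕ → Set α) → Prop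
  | .atom p, ξ => p ∈ ξ 0
  | .or φ ψ, ξ => φ.Sat ξ ∨ ψ.Sat ξ
  | .and φ ψ, ξ => φ.Sat ξ ∧ ψ.Sat ξ
  | .next φ, ξ => φ.Sat (traceSuffix ξ 1)
  | .untl φ ψ, ξ => ∃ k, ψ.Sat (traceSuffix ξ k) ∧ ∀ i < k, φ.Sat (traceSuffix ξ i)
  | .ev φ, ξ => ∃ k, φ.Sat (traceSuffix ξ k)
  | .untlLe k φ ψ, ξ =>
      ∃ j ≤ k, ψ.Sat (traceSuffix ξ j) ∧ ∀ i < j, φ.Sat (traceSuffix ξ i)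
  | .evLe k φ, ξ => ∃ j ≤ k, φ.Sat (traceSuffix ξ j)
  | .alwLe k φ, ξ => ∀ j ≤ k, φ.Sat (traceSuffix ξ j)

/-- Replace `p` by `Sum.inl p` and `¬ p` by `Sum.inr p`. -/
def CsLTL.bar {Υ : Type*} : CsLTL Υ → PosLTL (Υ ⊕ Υ)
  | .atom p => .atom (.inl p)
  | .negAtom p => .atom (.inr p)
  | .or φ ψ => .or φ.bar ψ.bar
  | .and φ ψ => .and φ.bar ψ.bar
  | .next φ => .next φ.bar
  | .untl φ ψ => .untl φ.bar ψ.bar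
  | .ev φ => .ev φ.bar

/-- `BLTL.barAux true φ` and `BLTL.barAux false φ` are the translations of `φ` and of `¬ φ`:
negations are pushed to the atoms and then `p` becomes `Sum.inl p` and `¬ p` becomes `Sum.inr p`.
The negation of `φ U^{≤ k} ψ` is `G^{≤ k} ¬ ψ ∨ (¬ ψ U^{≤ k} (¬ φ ∧ ¬ ψ))`. -/
def BLTL.barAux {Υ : Type*} : Bool → BLTL Υ → PosLTL (Υ ⊕ Υ)
  | true, .atom p => .atom (.inl p)
  | false, .atom p => .atom (.inr p)
  | true, .neg φ => φ.barAux false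
  | false, .neg φ => φ.barAux true
  | true, .or φ ψ => .or (φ.barAux true) (ψ.barAux true)
  | false, .or φ ψ => .and (φ.barAux false) (ψ.barAux false)
  | true, .next φ => .next (φ.barAux true)
  | false, .next φ => .next (φ.barAux false)
  | true, .untlLe k φ ψ => .untlLe k (φ.barAux true) (ψ.barAux true)
  | false, .untlLe k φ ψ =>
      .or (.alwLe k (ψ.barAux false))
        (.untlLe k (ψ.barAux false) (.and (φ.barAux false) (ψ.barAux false)))
  | true, .evLe k φ => .evLe k (φ.barAux true)
  | false, .evLe k φ => .alwLe k (φ.barAux false)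
  | true, .alwLe k φ => .alwLe k (φ.barAux true)
  | false, .alwLe k φ => .evLe k (φ.barAux false)

/-- A specification: a co-safe or a bounded formula. -/
inductive Spec (Υ : Type*) where
  | cs (φ : CsLTL Υ)
  | bounded (φ : BLTL Υ)

/-- Satisfaction of a specification by an infinite trace. -/
def Spec.Sat {Υ : Type*} : Spec Υ → (ℕ → Set Υ) → Prop
  | .cs φ, ξ => φ.Sat ξ
  | .bounded φ, ξ => φ.Sat ξ

/-- The negation-free translation of a specification. -/
def Spec.bar {Υ : Type*} : Spec Υ → PosLTL (Υ ⊕ Υ)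
  | .cs φ => φ.bar
  | .bounded φ => φ.barAux true

/-- A finite trace is a good prefix of `φ` if each of its infinite extensions satisfies `φ`. -/
def Spec.IsGoodPrefix {Υ : Type*} (φ : Spec Υ) (w : List (Set Υ)) : Prop :=
  ∀ ξ : ℕ → Set Υ, φ.Sat (appendTrace w ξ)

/-- The set of literals that hold at a position with label set `S`: `Sum.inl p` for `p ∈ S`,
`Sum.inr p` for `p ∉ S`. -/
def litSet {Υ : Type*} (S : Set Υ) : Set (Υ ⊕ Υ) := Sum.inl '' S ∪ Sum.inr '' Sᶜ

/-- A finite word of label sets over the doubled propositions is a good prefix of the translated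
formula if it satisfies it whatever infinite trace over the original propositions follows. The word
itself may be incomplete (neither `p` nor `¬ p`) or ambiguous (both). -/
def Spec.IsGoodPrefixBar {Υ : Type*} (φ : Spec Υ) (w : List (Set (Υ ⊕ Υ))) : Prop :=
  ∀ ξ : ℕ → Set Υ, φ.bar.Sat (appendTrace w (fun n => litSet (ξ n)))

/-! ## Linear stochastic hybrid systems -/

/-- A discrete-time linear stochastic hybrid system with modes `A`, continuous state space `ℝ^m`,
noise of dimension `r` and atomic propositions `Υ`, each given by its region. -/
structure SHS (A Υ : Type*) (m r : ℕ) where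
  /-- drift terms -/
  F : A → Matrix (Fin m) (Fin m) ℝ
  /-- diffusion terms -/
  G : A → Matrix (Fin m) (Fin r) ℝ
  /-- covariance matrix of the noise -/
  cov : Matrix (Fin r) (Fin r) ℝ
  cov_posSemidef : cov.PosSemidef
  /-- the region of interest of each proposition -/
  region : Υ → Set (EuclideanSpace ℝ (Fin m))

section System

variable {A Υ : Type*} {m r : ℕ}

/-- The labelling function of the system. -/
def SHS.label (H : SHS A Υ m r) (s : A × EuclideanSpace ℝ (Fin m)) : Set Υ :=
  {p | s.2 ∈ H.region p}

/-- One step of the dynamics: `F(a) x + G(a) w`. -/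
noncomputable def SHS.next (H : SHS A Υ m r)
    (p : (A × EuclideanSpace ℝ (Fin m)) × EuclideanSpace ℝ (Fin r)) : EuclideanSpace ℝ (Fin m) :=
  (H.F p.1.1).toEuclideanLin p.1.2 + (H.G p.1.1).toEuclideanLin p.2

variable [Finite A] [MeasurableSpace A] [DiscreteMeasurableSpace A]

theorem SHS.measurable_next (H : SHS A Υ m r) : Measurable H.next := by
  have h : ∀ a, Measurable fun q : EuclideanSpace ℝ (Fin m) × EuclideanSpace ℝ (Fin r) =>
      (H.F a).toEuclideanLin q.1 + (H.G a).toEuclideanLin q.2 := fun a =>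
    (((H.F a).toEuclideanLin.continuous_of_finiteDimensional.comp continuous_fst).add
      ((H.G a).toEuclideanLin.continuous_of_finiteDimensional.comp continuous_snd)).measurable
  have h' : Measurable fun q : A × (EuclideanSpace ℝ (Fin m) × EuclideanSpace ℝ (Fin r)) =>
      (H.F q.1).toEuclideanLin q.2.1 + (H.G q.1).toEuclideanLin q.2.2 :=
    measurable_from_prod_countable_right h
  have e : Measurable fun p : (A × EuclideanSpace ℝ (Fin m)) × EuclideanSpace ℝ (Fin r) =>
      (p.1.1, (p.1.2, p.2)) :=
    (measurable_fst.comp measurable_fst).prodMk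
      ((measurable_snd.comp measurable_fst).prodMk measurable_snd)
  have h'' := h'.comp e
  exact h''

/-- The transition kernel: `T(· | x, a)` is the law of `F(a) x + G(a) w`, where `w` is a centred
Gaussian vector with covariance matrix `cov`. -/
noncomputable def SHS.T (H : SHS A Υ m r) :
    Kernel (A × EuclideanSpace ℝ (Fin m)) (EuclideanSpace ℝ (Fin m)) where
  toFun p := (multivariateGaussian 0 H.cov).map (fun w => H.next (p, w))
  measurable' := by
    have h : (fun p : A × EuclideanSpace ℝ (Fin m) =>
        (multivariateGaussian 0 H.cov).map (fun w => H.next (p, w))) =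
        fun p => ((multivariateGaussian 0 H.cov).map (Prod.mk p)).map H.next := by
      funext p
      rw [Measure.map_map H.measurable_next measurable_prodMk_left]
      rfl
    rw [h]
    exact (Measure.measurable_map _ H.measurable_next).comp Measurable.map_prodMk_left

instance (H : SHS A Υ m r) : IsMarkovKernel H.T :=
  ⟨fun _ => Measure.isProbabilityMeasure_map
    (H.measurable_next.comp measurable_prodMk_left).aemeasurable⟩

/-- A (measurable) switching strategy: it maps each finite path `s₀ … sₙ` to a mode. -/
structure SwitchingStrategy (A : Type*) [MeasurableSpace A] (m : ℕ) where
  act : (n : ℕ) → (Finset.Iic n → A × EuclideanSpace ℝ (Fin m)) → A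
  measurable_act : ∀ n, Measurable (act n)

/-- The law of the next hybrid state given the path `h = s₀ … sₙ`: the strategy chooses the mode
`a`, the continuous state moves according to `T(· | xₙ, a)`, and the new mode is `a`. -/
noncomputable def SHS.stepKernel (H : SHS A Υ m r) (σ : SwitchingStrategy A m) (n : ℕ) :
    Kernel (Finset.Iic n → A × EuclideanSpace ℝ (Fin m)) (A × EuclideanSpace ℝ (Fin m)) :=
  (Kernel.deterministic Prod.fst measurable_fst ×ₖ H.T).comap
    (fun h => (σ.act n h, (h ⟨n, Finset.mem_Iic.2 le_rfl⟩).2))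
    ((σ.measurable_act n).prodMk (measurable_snd.comp (measurable_pi_apply _)))

instance (H : SHS A Υ m r) (σ : SwitchingStrategy A m) (n : ℕ) :
    IsMarkovKernel (H.stepKernel σ n) := by
  unfold SHS.stepKernel; infer_instance

/-- The law of the infinite path from `s₀` under the strategy `σ` (Ionescu-Tulcea). -/
noncomputable def SHS.pathMeasure (H : SHS A Υ m r) (σ : SwitchingStrategy A m)
    (s₀ : A × EuclideanSpace ℝ (Fin m)) : Measure (ℕ → A × EuclideanSpace ℝ (Fin m)) :=
  Kernel.traj (X := fun _ => A × EuclideanSpace ℝ (Fin m)) (H.stepKernel σ) 0 (fun _ => s₀)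

/-- The paths some finite prefix `s₀ … s_k` of which stays in `A × X` and has a trace that is a good
prefix of `φ`. -/
def SHS.satEvent (H : SHS A Υ m r) (X : Set (EuclideanSpace ℝ (Fin m))) (φ : Spec Υ) :
    Set (ℕ → A × EuclideanSpace ℝ (Fin m)) :=
  {ω | ∃ k, (∀ i ≤ k, (ω i).2 ∈ X) ∧
    φ.IsGoodPrefix (List.ofFn fun i : Fin (k + 1) => H.label (ω i))}

/-- `P(φ | s₀, X, σ)`. -/
noncomputable def SHS.satProb (H : SHS A Υ m r) (X : Set (EuclideanSpace ℝ (Fin m))) (φ : Spec Υ)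
    (σ : SwitchingStrategy A m) (s₀ : A × EuclideanSpace ℝ (Fin m)) : ℝ :=
  (H.pathMeasure σ s₀).real (H.satEvent X φ)

end System

/-! ## Interval Markov decision processes -/

/-- The lower and upper transition probabilities of an interval Markov decision process. -/
structure IMDP (Q A : Type*) where
  lower : Q → A → Q → ℝ
  upper : Q → A → Q → ℝ

section IMDP

variable {Q A M : Type*}

/-- The product with a deterministic memory that is updated by the state that is entered. -/
noncomputable def IMDP.prod (I : IMDP Q A) (δ : M → Q → M) : IMDP (Q × M) A where
  lower s a s' := open Classical in if s'.2 = δ s.2 s'.1 then I.lower s.1 a s'.1 else 0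
  upper s a s' := open Classical in if s'.2 = δ s.2 s'.1 then I.upper s.1 a s'.1 else 0

variable [Fintype Q]

/-- Feasible distributions. -/
def IMDP.feasible (I : IMDP Q A) (q : Q) (a : A) : Set (Q → ℝ) :=
  {γ | γ ∈ stdSimplex ℝ Q ∧ ∀ q', I.lower q a q' ≤ γ q' ∧ γ q' ≤ I.upper q a q'}

/-- The least expectation of `V` after one step, over the feasible distributions. -/
noncomputable def IMDP.minExp (I : IMDP Q A) (V : Q → ℝ) (q : Q) (a : A) : ℝ :=
  sInf ((fun γ : Q → ℝ => ∑ q', γ q' * V q') '' I.feasible q a)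

/-- The greatest expectation of `V` after one step, over the feasible distributions. -/
noncomputable def IMDP.maxExp (I : IMDP Q A) (V : Q → ℝ) (q : Q) (a : A) : ℝ :=
  sSup ((fun γ : Q → ℝ => ∑ q', γ q' * V q') '' I.feasible q a)

open Classical in
/-- Recursive evaluation of a Bellman equation with value `1` on `acc` and right-hand side `B`
elsewhere, started from `0` off `acc`. -/
noncomputable def bellmanIter (acc : Set Q) (B : (Q → ℝ) → Q → ℝ) : ℕ → Q → ℝ
  | 0 => fun q => if q ∈ acc then 1 else 0
  | n + 1 => fun q => if q ∈ acc then 1 else B (bellmanIter acc B n) q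

/-- The value of the Bellman equation: the limit of its (nondecreasing) recursive evaluations. -/
noncomputable def bellmanValue (acc : Set Q) (B : (Q → ℝ) → Q → ℝ) (q : Q) : ℝ :=
  ⨆ n, bellmanIter acc B n q

/-- Optimal lower bound: maximize over actions, minimize over feasible distributions. -/
noncomputable def IMDP.optLowerValue (I : IMDP Q A) (acc : Set Q) : Q → ℝ :=
  bellmanValue acc fun V q => ⨆ a, I.minExp V q a

/-- Lower bound on the probability of reaching `acc` under the stationary strategy `σ`. -/
noncomputable def IMDP.lowerValue (I : IMDP Q A) (acc : Set Q) (σ : Q → A) : Q → ℝ :=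
  bellmanValue acc fun V q => I.minExp V q (σ q)

/-- Upper bound on the probability of reaching `acc` under the stationary strategy `σ`. -/
noncomputable def IMDP.upperValue (I : IMDP Q A) (acc : Set Q) (σ : Q → A) : Q → ℝ :=
  bellmanValue acc fun V q => I.maxExp V q (σ q)

/-- `σ` is a stationary strategy that attains the optimal lower bound at every state. -/
def IMDP.IsOptimal (I : IMDP Q A) (acc : Set Q) (σ : Q → A) : Prop :=
  ∀ q, I.lowerValue acc σ q = I.optLowerValue acc q

end IMDP

/-! ## The abstraction -/

/-- A discretization of `A × X`: for each mode `a`, the set `X` is the union of finitely many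
full-dimensional polytopes that overlap in Lebesgue null sets only. -/
structure Discretization {A : Type*} {m : ℕ} (X : Set (EuclideanSpace ℝ (Fin m)))
    (Cell : A → Type*) where
  cell : (a : A) → Cell a → Set (EuclideanSpace ℝ (Fin m))
  polytope : ∀ a c, ∃ V : Finset (EuclideanSpace ℝ (Fin m)), cell a c = convexHull ℝ (V : Set _)
  fullDim : ∀ a c, (interior (cell a c)).Nonempty
  cover : ∀ a, ⋃ c, cell a c = X
  overlap : ∀ a c c', c ≠ c' → volume (cell a c ∩ cell a c') = 0

/-- States of the abstraction: the cells of all modes, and `none` for the complement of `A × X`. -/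
abbrev AbsState {A : Type*} (Cell : A → Type*) := Option (Σ a, Cell a)

section Abstraction

variable {A Υ : Type*} {m r : ℕ} {X : Set (EuclideanSpace ℝ (Fin m))} {Cell : A → Type*}

/-- The literal `Sum.inl p` has the region of `p`, the literal `Sum.inr p` its complement in `X`. -/
def SHS.litRegion (H : SHS A Υ m r) (X : Set (EuclideanSpace ℝ (Fin m))) :
    Υ ⊕ Υ → Set (EuclideanSpace ℝ (Fin m))
  | .inl p => H.region p
  | .inr p => X \ H.region p

/-- The under-approximating labelling: the literals whose region contains the cell. -/
def Discretization.labelUnder (D : Discretization X Cell) (H : SHS A Υ m r) :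
    AbsState Cell → Set (Υ ⊕ Υ)
  | some i => {p | D.cell i.1 i.2 ⊆ H.litRegion X p}
  | none => ∅

/-- The over-approximating labelling: the literals whose region meets the cell. -/
def Discretization.labelOver (D : Discretization X Cell) (H : SHS A Υ m r) :
    AbsState Cell → Set (Υ ⊕ Υ)
  | some i => {p | (D.cell i.1 i.2 ∩ H.litRegion X p).Nonempty}
  | none => ∅

variable [Fintype A] [MeasurableSpace A] [DiscreteMeasurableSpace A]

open Classical in
/-- The abstraction of the system: action `a` leads into cells of mode `a` or out of `A × X`, with
the extremal probabilities over the points of the current cell; the outside is absorbing. -/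
noncomputable def Discretization.imdp (D : Discretization X Cell) (H : SHS A Υ m r) :
    IMDP (AbsState Cell) A where
  lower
    | some i, a, some j =>
        if j.1 = a then ⨅ x : D.cell i.1 i.2, (H.T (a, (x : EuclideanSpace ℝ (Fin m)))).real
          (D.cell j.1 j.2) else 0
    | some i, a, none =>
        1 - ⨆ x : D.cell i.1 i.2, (H.T (a, (x : EuclideanSpace ℝ (Fin m)))).real X
    | none, _, some _ => 0
    | none, _, none => 1
  upper
    | some i, a, some j =>
        if j.1 = a then ⨆ x : D.cell i.1 i.2, (H.T (a, (x : EuclideanSpace ℝ (Fin m)))).real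
          (D.cell j.1 j.2) else 0
    | some i, a, none =>
        1 - ⨅ x : D.cell i.1 i.2, (H.T (a, (x : EuclideanSpace ℝ (Fin m)))).real X
    | none, _, some _ => 0
    | none, _, none => 1

/-- A measurable assignment of hybrid states to abstract states: `(a, x)` with `x ∈ X` goes to a
cell of mode `a` that contains `x` (on common boundaries one of them is selected), and `(a, x)`
with `x ∉ X` goes to `none`. -/
structure Quantizer (D : Discretization X Cell) where
  abs : A × EuclideanSpace ℝ (Fin m) → AbsState Cell
  inside : ∀ a, ∀ x ∈ X, ∃ c : Cell a, abs (a, x) = some ⟨a, c⟩ ∧ x ∈ D.cell a c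
  outside : ∀ a, ∀ x ∉ X, abs (a, x) = none
  measurableSet_fiber : ∀ q, MeasurableSet (abs ⁻¹' {q})

/-- The switching strategy to which a strategy `σ` on the product of the abstraction (labelled by
`L`) and the automaton `𝒜` is refined: on the path `s₀ … sₙ` with abstract states `q₀ … qₙ` the
mode is `σ (qₙ, z)`, where `z` is the state of `𝒜` after it has read `L q₀ … L qₙ`. -/
def Quantizer.refine {α Z : Type*} [∀ a, Finite (Cell a)] {D : Discretization X Cell}
    (κ : Quantizer D) (L : AbsState Cell → Set α) (𝒜 : DFA (Set α) Z)
    (σ : AbsState Cell × Z → A) : SwitchingStrategy A m where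
  act n h := σ (κ.abs (h ⟨n, Finset.mem_Iic.2 le_rfl⟩),
    𝒜.eval (List.ofFn fun i : Fin (n + 1) =>
      L (κ.abs (h ⟨i, Finset.mem_Iic.2 (Nat.lt_succ_iff.1 i.2)⟩))))
  measurable_act n := by
    let _ : MeasurableSpace (AbsState Cell) := ⊤
    have hκ : Measurable κ.abs := measurable_to_countable' κ.measurableSet_fiber
    have h1 : Measurable fun (h : Finset.Iic n → A × EuclideanSpace ℝ (Fin m)) i =>
        κ.abs (h i) := measurable_pi_lambda _ fun i => hκ.comp (measurable_pi_apply i)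
    have h2 : Measurable fun g : Finset.Iic n → AbsState Cell =>
        σ (g ⟨n, Finset.mem_Iic.2 le_rfl⟩, 𝒜.eval (List.ofFn fun i : Fin (n + 1) =>
          L (g ⟨i, Finset.mem_Iic.2 (Nat.lt_succ_iff.1 i.2)⟩))) := Measurable.of_discrete
    exact h2.comp h1

variable [∀ a, Fintype (Cell a)] {Z : Type*}

/-- The product of the abstraction with the labelling `labelUnder` and the automaton. -/
noncomputable def Discretization.productUnder (D : Discretization X Cell) (H : SHS A Υ m r)
    (𝒜 : DFA (Set (Υ ⊕ Υ)) Z) : IMDP (AbsState Cell × Z) A :=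
  (D.imdp H).prod fun z q => 𝒜.step z (D.labelUnder H q)

/-- The product of the abstraction with the labelling `labelOver` and the automaton (second copy of
`Z`), which also carries, as the memory of a strategy that was computed on `productUnder`, the run
of the automaton on the labels `labelUnder` (first copy of `Z`). -/
noncomputable def Discretization.productOver (D : Discretization X Cell) (H : SHS A Υ m r)
    (𝒜 : DFA (Set (Υ ⊕ Υ)) Z) : IMDP (AbsState Cell × Z × Z) A :=
  (D.imdp H).prod fun z q => (𝒜.step z.1 (D.labelUnder H q), 𝒜.step z.2 (D.labelOver H q))

/-- The accepting states of `productUnder`. -/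
def accUnder (Cell : A → Type*) {α : Type*} (𝒜 : DFA α Z) : Set (AbsState Cell × Z) :=
  {s | s.2 ∈ 𝒜.accept}

/-- The accepting states of `productOver`. -/
def accOver (Cell : A → Type*) {α : Type*} (𝒜 : DFA α Z) : Set (AbsState Cell × Z × Z) :=
  {s | s.2.2 ∈ 𝒜.accept}

variable [Fintype Z]

/-- The optimal lower bound for the formula from the abstract state `q`, by the labelling
`labelUnder`; the automaton has read the label of `q`. -/
noncomputable def Discretization.lowerBound (D : Discretization X Cell) (H : SHS A Υ m r)
    (𝒜 : DFA (Set (Υ ⊕ Υ)) Z) (q : AbsState Cell) : ℝ :=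
  (D.productUnder H 𝒜).optLowerValue (accUnder Cell 𝒜) (q, 𝒜.step 𝒜.start (D.labelUnder H q))

/-- The upper bound for the formula from the abstract state `q` under the strategy `σ`, by the
labelling `labelOver`; the automaton has read the label of `q`. -/
noncomputable def Discretization.upperBound (D : Discretization X Cell) (H : SHS A Υ m r)
    (𝒜 : DFA (Set (Υ ⊕ Υ)) Z) (σ : AbsState Cell × Z → A) (q : AbsState Cell) : ℝ :=
  (D.productOver H 𝒜).upperValue (accOver Cell 𝒜) (fun s => σ (s.1, s.2.1))
    (q, 𝒜.step 𝒜.start (D.labelUnder H q), 𝒜.step 𝒜.start (D.labelOver H q))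

end Abstraction

/-! The proof is a backward induction over the recursive evaluations `V n` in the product of
abstraction and automaton. From a point of a cell, one step of the system induces a law on the
abstract states, and this law is feasible (`Quantizer.fiberLaw_mem_feasible`). The point at issue is
that a state on a common boundary is assigned to one cell, whereas the intervals count whole cells;
but overlaps are convex Lebesgue null sets, hence empty or contained in hyperplanes, and
nondegenerate noise does not charge these. So the expectation of `V n` after one step is at least `V
(n + 1)` for the minimizing recursion and at most `V (n + 1)` for the maximizing one, and `n` steps
compare `V n` at the start with the probability of acceptance by time `n`
(`bellmanIter_min_le_real_acceptedBy`, `real_acceptedBy_le_bellmanIter_max`).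

That probability belongs to a modified run, `stoppedRun`. The Bellman values freeze acceptance and
make the outside absorbing, whereas the system may return to `X`, and the automaton may leave an
accepting state, since an incomplete label appended to a good prefix can spoil it. Once outside, the
modified run reads empty labels whatever the system does; these create no new acceptance, because an
empty last label can be dropped (`Spec.IsGoodPrefixBar.of_append_empty`).

On the logical side, the translated formula has no negation, so enlarging labels preserves it
(`PosLTL.Sat.mono`). At a point of `X` the true literals lie between the under- and the
over-approximating label of its cell. Hence acceptance on the under labels yields a good prefix, and
a good prefix yields acceptance on the over labels. For the upper bound the memory is a pair of
automaton states, because the strategy still follows the under labels. -/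

/-! ## Good prefixes -/

/-- Satisfaction of a negation-free formula is monotone in the trace. -/
theorem PosLTL.Sat.mono {α : Type*} {φ : PosLTL α} {ξ ξ' : ℕ → Set α} (h : φ.Sat ξ)
    (hξ : ∀ n, ξ n ⊆ ξ' n) : φ.Sat ξ' := by
  have suf : ∀ {ξ ξ' : ℕ → Set α}, (∀ n, ξ n ⊆ ξ' n) →
      ∀ k n, traceSuffix ξ k n ⊆ traceSuffix ξ' k n := fun h k n => h (k + n)
  induction φ generalizing ξ ξ' with
  | atom p => exact hξ 0 h
  | or φ ψ ih₁ ih₂ => exact h.imp (ih₁ · hξ) (ih₂ · hξ)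
  | and φ ψ ih₁ ih₂ => exact ⟨ih₁ h.1 hξ, ih₂ h.2 hξ⟩
  | next φ ih => exact ih h (suf hξ 1)
  | untl φ ψ ih₁ ih₂ =>
    obtain ⟨k, hk, hi⟩ := h
    exact ⟨k, ih₂ hk (suf hξ k), fun i hik => ih₁ (hi i hik) (suf hξ i)⟩
  | ev φ ih =>
    obtain ⟨k, hk⟩ := h
    exact ⟨k, ih hk (suf hξ k)⟩
  | untlLe k φ ψ ih₁ ih₂ =>
    obtain ⟨j, hjk, hj, hi⟩ := h
    exact ⟨j, hjk, ih₂ hj (suf hξ j), fun i hij => ih₁ (hi i hij) (suf hξ i)⟩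
  | evLe k φ ih =>
    obtain ⟨j, hjk, hj⟩ := h
    exact ⟨j, hjk, ih hj (suf hξ j)⟩
  | alwLe k φ ih => exact fun j hj => ih (h j hj) (suf hξ j)

theorem inl_mem_litSet {Υ : Type*} {S : Set Υ} {p : Υ} : Sum.inl p ∈ litSet S ↔ p ∈ S := by
  simp [litSet]

theorem inr_mem_litSet {Υ : Type*} {S : Set Υ} {p : Υ} : Sum.inr p ∈ litSet S ↔ p ∉ S := by
  simp [litSet]

/-- The suffix of a trace of literal sets is the trace of literal sets of the suffix. -/
theorem traceSuffix_litSet {Υ : Type*} (ξ : ℕ → Set Υ) (k : ℕ) :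
    traceSuffix (fun n => litSet (ξ n)) k = fun n => litSet (traceSuffix ξ k n) := rfl

theorem CsLTL.sat_bar {Υ : Type*} (φ : CsLTL Υ) (ξ : ℕ → Set Υ) :
    φ.bar.Sat (fun n => litSet (ξ n)) ↔ φ.Sat ξ := by
  induction φ generalizing ξ with
  | atom p => exact inl_mem_litSet
  | negAtom p => exact inr_mem_litSet
  | or φ ψ ih₁ ih₂ => simp only [bar, Sat, PosLTL.Sat, ih₁, ih₂]
  | and φ ψ ih₁ ih₂ => simp only [bar, Sat, PosLTL.Sat, ih₁, ih₂]
  | next φ ih => simp only [bar, Sat, PosLTL.Sat, traceSuffix_litSet, ih]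
  | untl φ ψ ih₁ ih₂ => simp only [bar, Sat, PosLTL.Sat, traceSuffix_litSet, ih₁, ih₂]
  | ev φ ih => simp only [bar, Sat, PosLTL.Sat, traceSuffix_litSet, ih]

/-- The negation of a bounded until. -/
theorem not_exists_untilLe_iff (k : ℕ) (P R : ℕ → Prop) :
    ((∀ j ≤ k, ¬ R j) ∨ ∃ j ≤ k, (¬ P j ∧ ¬ R j) ∧ ∀ i < j, ¬ R i) ↔
      ¬ ∃ j ≤ k, R j ∧ ∀ i < j, P i := by
  constructor
  · rintro (h | ⟨j, -, ⟨hP, hR⟩, hlt⟩) ⟨j', hj', hR', hP'⟩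
    · exact h j' hj' hR'
    · rcases lt_trichotomy j j' with hlt' | rfl | hlt'
      · exact hP (hP' j hlt')
      · exact hR hR'
      · exact hlt j' hlt' hR'
  · intro h
    by_cases hR : ∀ j ≤ k, ¬ R j
    · exact Or.inl hR
    · right
      push Not at hR
      classical
      -- The witness is a place before the first `R` at which `P` fails: if there were none, the
      -- first `R` would fulfil the until.
      have hex : ∃ j, j ≤ k ∧ R j := hR
      have hspec := Nat.find_spec hex
      have hP : ∃ i < Nat.find hex, ¬ P i := by
        by_contra! hcon
        exact h ⟨_, hspec.1, hspec.2, hcon⟩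
      obtain ⟨i, hi, hPi⟩ := hP
      have hno : ∀ i' < Nat.find hex, ¬ R i' := fun i' hi' hRi' =>
        Nat.find_min hex hi' ⟨hi'.le.trans hspec.1, hRi'⟩
      exact ⟨i, hi.le.trans hspec.1, ⟨hPi, hno i hi⟩, fun i' hi' => hno i' (hi'.trans hi)⟩

/-- Both polarities go through one induction, since a negation exchanges them. -/
theorem BLTL.sat_barAux {Υ : Type*} (φ : BLTL Υ) (ξ : ℕ → Set Υ) :
    ((φ.barAux true).Sat (fun n => litSet (ξ n)) ↔ φ.Sat ξ) ∧
      ((φ.barAux false).Sat (fun n => litSet (ξ n)) ↔ ¬ φ.Sat ξ) := by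
  induction φ generalizing ξ with
  | atom p => exact ⟨inl_mem_litSet, inr_mem_litSet⟩
  | neg φ ih => simp only [barAux, Sat, ih, not_not, and_self]
  | or φ ψ ih₁ ih₂ => simp only [barAux, Sat, PosLTL.Sat, ih₁, ih₂, not_or, and_self]
  | next φ ih => simp only [barAux, Sat, PosLTL.Sat, traceSuffix_litSet, ih, and_self]
  | untlLe k φ ψ ih₁ ih₂ =>
    simp only [barAux, Sat, PosLTL.Sat, traceSuffix_litSet, ih₁, ih₂, true_and]
    exact not_exists_untilLe_iff k (fun j => φ.Sat (traceSuffix ξ j))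
      (fun j => ψ.Sat (traceSuffix ξ j))
  | evLe k φ ih =>
    simp only [barAux, Sat, PosLTL.Sat, traceSuffix_litSet, ih, true_and]
    push Not
    rfl
  | alwLe k φ ih =>
    simp only [barAux, Sat, PosLTL.Sat, traceSuffix_litSet, ih, true_and]
    push Not
    rfl

theorem Spec.sat_bar {Υ : Type*} (φ : Spec Υ) (ξ : ℕ → Set Υ) :
    φ.bar.Sat (fun n => litSet (ξ n)) ↔ φ.Sat ξ := by
  cases φ with
  | cs φ => exact φ.sat_bar ξ
  | bounded φ => exact (φ.sat_barAux ξ).1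

/-- Complete words are good prefixes of the translation iff the original words are good prefixes. -/
theorem Spec.isGoodPrefixBar_map_litSet {Υ : Type*} (φ : Spec Υ) (w : List (Set Υ)) :
    φ.IsGoodPrefixBar (w.map litSet) ↔ φ.IsGoodPrefix w := by
  refine forall_congr' fun ξ => ?_
  rw [← φ.sat_bar]
  have : appendTrace (w.map litSet) (fun n => litSet (ξ n)) =
      fun n => litSet (appendTrace w ξ n) := by
    funext n
    by_cases h : n < w.length <;> simp [appendTrace, h]
  rw [this]

theorem Spec.IsGoodPrefixBar.mono {Υ : Type*} {φ : Spec Υ} {w w' : List (Set (Υ ⊕ Υ))}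
    (h : φ.IsGoodPrefixBar w) (hlen : w.length = w'.length)
    (hw : ∀ n (h₁ : n < w.length) (h₂ : n < w'.length), w[n] ⊆ w'[n]) :
    φ.IsGoodPrefixBar w' := fun ξ => (h ξ).mono fun n => by
  by_cases hn : n < w.length
  · simpa [appendTrace, hn, hlen ▸ hn] using hw n hn (hlen ▸ hn)
  · simp [appendTrace, hlen ▸ hn, hlen]

/-- An empty label at the end of a good prefix is redundant. -/
theorem Spec.IsGoodPrefixBar.of_append_empty {Υ : Type*} {φ : Spec Υ} {w : List (Set (Υ ⊕ Υ))}
    (h : φ.IsGoodPrefixBar (w ++ [∅])) : φ.IsGoodPrefixBar w := fun ξ =>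
  -- The extra position is filled by the head of `ξ`: there `∅` is below the literal set of `ξ 0`,
  -- and everywhere else the two traces agree.
  (h (traceSuffix ξ 1)).mono fun n => by
    rcases lt_trichotomy n w.length with hn | rfl | hn
    · simp [appendTrace, hn, Nat.lt_succ_of_lt hn]
    · simp [appendTrace]
    · have h₁ : ¬ n < w.length := by omega
      have h₂ : ¬ n < w.length + 1 := by omega
      have h₃ : 1 + (n - (w.length + 1)) = n - w.length := by omega
      simp [appendTrace, traceSuffix, h₁, h₂, h₃]

/-! ## Bellman operators of interval Markov decision processes -/

section BellmanIter

variable {Q : Type*}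

/-- Boundedness is what gives the real infima and suprema over feasible distributions, and the
supremum over iterates, their intended meaning. -/
theorem bellmanIter_mem_Icc {acc : Set Q} {B : (Q → ℝ) → Q → ℝ}
    (hB : ∀ V, (∀ q, V q ∈ Set.Icc (0 : ℝ) 1) → ∀ q, B V q ∈ Set.Icc (0 : ℝ) 1) (n : ℕ) (q : Q) :
    bellmanIter acc B n q ∈ Set.Icc (0 : ℝ) 1 := by
  induction n generalizing q with
  | zero => by_cases h : q ∈ acc <;> simp [bellmanIter, h]
  | succ n ih =>
    by_cases h : q ∈ acc
    · simp [bellmanIter, h]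
    · simpa [bellmanIter, h] using hB _ ih q

theorem bellmanIter_of_mem {acc : Set Q} {B : (Q → ℝ) → Q → ℝ} {q : Q} (hq : q ∈ acc) (n : ℕ) :
    bellmanIter acc B n q = 1 := by
  cases n <;> simp [bellmanIter, hq]

theorem bellmanIter_succ_of_notMem {acc : Set Q} {B : (Q → ℝ) → Q → ℝ} {q : Q} (hq : q ∉ acc)
    (n : ℕ) : bellmanIter acc B (n + 1) q = B (bellmanIter acc B n) q := by
  simp [bellmanIter, hq]

end BellmanIter

section IMDPLemmas

variable {Q A M : Type*} [Fintype Q]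

theorem sum_mul_mem_Icc_of_mem_stdSimplex {γ V : Q → ℝ} (hγ : γ ∈ stdSimplex ℝ Q)
    (hV : ∀ q, V q ∈ Set.Icc (0 : ℝ) 1) : ∑ q, γ q * V q ∈ Set.Icc (0 : ℝ) 1 := by
  refine ⟨Finset.sum_nonneg fun q _ => mul_nonneg (hγ.1 q) (hV q).1, ?_⟩
  calc ∑ q, γ q * V q ≤ ∑ q, γ q :=
        Finset.sum_le_sum fun q _ => mul_le_of_le_one_right (hγ.1 q) (hV q).2
    _ = 1 := hγ.2

theorem IMDP.image_feasible_subset_Icc (I : IMDP Q A) {V : Q → ℝ}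
    (hV : ∀ q, V q ∈ Set.Icc (0 : ℝ) 1) (q : Q) (a : A) :
    (fun γ : Q → ℝ => ∑ q', γ q' * V q') '' I.feasible q a ⊆ Set.Icc 0 1 := by
  rintro _ ⟨γ, hγ, rfl⟩
  exact sum_mul_mem_Icc_of_mem_stdSimplex hγ.1 hV

theorem IMDP.minExp_mem_Icc (I : IMDP Q A) {V : Q → ℝ} (hV : ∀ q, V q ∈ Set.Icc (0 : ℝ) 1)
    (q : Q) (a : A) : I.minExp V q a ∈ Set.Icc (0 : ℝ) 1 := by
  have h := I.image_feasible_subset_Icc hV q a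
  refine ⟨Real.sInf_nonneg fun x hx => (h hx).1, ?_⟩
  -- With no feasible distribution the infimum takes the default value `0`, which also lies in the
  -- unit interval.
  rcases Set.eq_empty_or_nonempty
    ((fun γ : Q → ℝ => ∑ q', γ q' * V q') '' I.feasible q a) with h0 | ⟨x, hx⟩
  · rw [IMDP.minExp, h0, Real.sInf_empty]
    exact zero_le_one
  · exact (csInf_le ⟨0, fun y hy => (h hy).1⟩ hx).trans (h hx).2

theorem IMDP.maxExp_mem_Icc (I : IMDP Q A) {V : Q → ℝ} (hV : ∀ q, V q ∈ Set.Icc (0 : ℝ) 1)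
    (q : Q) (a : A) : I.maxExp V q a ∈ Set.Icc (0 : ℝ) 1 := by
  have h := I.image_feasible_subset_Icc hV q a
  exact ⟨Real.sSup_nonneg fun x hx => (h hx).1, Real.sSup_le (fun x hx => (h hx).2) zero_le_one⟩

theorem IMDP.minExp_le (I : IMDP Q A) {V : Q → ℝ} (hV : ∀ q, V q ∈ Set.Icc (0 : ℝ) 1)
    {q : Q} {a : A} {γ : Q → ℝ} (hγ : γ ∈ I.feasible q a) :
    I.minExp V q a ≤ ∑ q', γ q' * V q' :=
  csInf_le ⟨0, fun _ hy => (I.image_feasible_subset_Icc hV q a hy).1⟩ ⟨γ, hγ, rfl⟩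

theorem IMDP.le_maxExp (I : IMDP Q A) {V : Q → ℝ} (hV : ∀ q, V q ∈ Set.Icc (0 : ℝ) 1)
    {q : Q} {a : A} {γ : Q → ℝ} (hγ : γ ∈ I.feasible q a) :
    ∑ q', γ q' * V q' ≤ I.maxExp V q a :=
  le_csSup ⟨1, fun _ hy => (I.image_feasible_subset_Icc hV q a hy).2⟩ ⟨γ, hγ, rfl⟩

variable [Fintype M]

open Classical in
theorem IMDP.sum_prod_mul {δ : M → Q → M} (γ : Q → ℝ) (V : Q × M → ℝ) (z : M) :
    ∑ s : Q × M, (if s.2 = δ z s.1 then γ s.1 else 0) * V s = ∑ q, γ q * V (q, δ z q) := by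
  rw [Fintype.sum_prod_type]
  refine Finset.sum_congr rfl fun q _ => ?_
  simp [ite_mul]

open Classical in
/-- A feasible distribution lifts to the product with a memory. -/
theorem IMDP.prod_mem_feasible (I : IMDP Q A) (δ : M → Q → M) {q : Q} {a : A} {γ : Q → ℝ}
    (hγ : γ ∈ I.feasible q a) (z : M) :
    (fun s : Q × M => if s.2 = δ z s.1 then γ s.1 else 0) ∈ (I.prod δ).feasible (q, z) a := by
  refine ⟨⟨fun s => ?_, ?_⟩, fun s => ?_⟩
  · beta_reduce
    split_ifs
    exacts [hγ.1.1 _, le_rfl]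
  · have := IMDP.sum_prod_mul (δ := δ) γ (fun _ => 1) z
    simp only [mul_one] at this
    rw [this]
    exact hγ.1.2
  · simp only [IMDP.prod]
    split_ifs
    exacts [hγ.2 _, ⟨le_rfl, le_rfl⟩]

/-- Only lifted distributions matter here: each one competes in the extremum over the product, so no
converse description of the feasible set of the product is needed. -/
theorem IMDP.prod_minExp_le (I : IMDP Q A) (δ : M → Q → M) {V : Q × M → ℝ}
    (hV : ∀ s, V s ∈ Set.Icc (0 : ℝ) 1) {q : Q} {a : A} {γ : Q → ℝ} (hγ : γ ∈ I.feasible q a)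
    (z : M) : (I.prod δ).minExp V (q, z) a ≤ ∑ q', γ q' * V (q', δ z q') := by
  classical
  rw [← IMDP.sum_prod_mul]
  exact IMDP.minExp_le _ hV (I.prod_mem_feasible δ hγ z)

theorem IMDP.le_prod_maxExp (I : IMDP Q A) (δ : M → Q → M) {V : Q × M → ℝ}
    (hV : ∀ s, V s ∈ Set.Icc (0 : ℝ) 1) {q : Q} {a : A} {γ : Q → ℝ} (hγ : γ ∈ I.feasible q a)
    (z : M) : ∑ q', γ q' * V (q', δ z q') ≤ (I.prod δ).maxExp V (q, z) a := by
  classical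
  rw [← IMDP.sum_prod_mul]
  exact IMDP.le_maxExp _ hV (I.prod_mem_feasible δ hγ z)

end IMDPLemmas

/-! ## Runs driven by a finite observation of a trajectory -/

/-- If `g` is below the conditional expectation of `F` given the path up to time `k`, then the
expectation of `g` is below the expectation of `F`. -/
theorem integral_frestrictLe_le_integral_succ {X : ℕ → Type*} [∀ n, MeasurableSpace (X n)]
    {κ : (n : ℕ) → Kernel (Π i : Finset.Iic n, X i) (X (n + 1))}
    [∀ n, IsMarkovKernel (κ n)] (x₀ : Π i : Finset.Iic 0, X i) {k : ℕ}
    {g : (Π i : Finset.Iic k, X i) → ℝ} {F : (Π i : Finset.Iic k, X i) × X (k + 1) → ℝ}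
    (hg : Measurable g)
    (hgi : ∀ μ : Measure (Π i : Finset.Iic k, X i), IsFiniteMeasure μ → Integrable g μ)
    (hF : Measurable F)
    (hFi : ∀ μ : Measure ((Π i : Finset.Iic k, X i) × X (k + 1)),
      IsFiniteMeasure μ → Integrable F μ)
    (h : ∀ x, g x ≤ ∫ s, F (x, s) ∂κ k x) :
    ∫ ω, g (Preorder.frestrictLe k ω) ∂Kernel.traj κ 0 x₀ ≤
      ∫ ω, F (Preorder.frestrictLe k ω, ω (k + 1)) ∂Kernel.traj κ 0 x₀ := by
  -- The joint law of the path up to `k` and the next state is the composition-product of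
  -- `Kernel.partialTraj` with `κ k`, so the right side becomes an iterated integral over the same
  -- law as the left side.
  rw [← integral_map (f := g) (Preorder.measurable_frestrictLe k).aemeasurable
      hg.aestronglyMeasurable,
    ← integral_map (f := F) (φ := fun ω : (n : ℕ) → X n => (Preorder.frestrictLe k ω, ω (k + 1)))
      (by fun_prop) hF.aestronglyMeasurable,
    Kernel.traj_map_frestrictLe_apply, ← Kernel.partialTraj_compProd_eq_map_traj (Nat.zero_le k),
    Measure.integral_compProd (hFi _ inferInstance)]
  have hFint : Integrable F (Kernel.partialTraj κ 0 k x₀ ⊗ₘ κ k) := hFi _ inferInstance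
  rw [Measure.compProd] at hFint
  exact integral_mono (hgi _ inferInstance) (by simpa using hFint.integral_compProd) h

section Run

variable {P Q S : Type*}

/-- The run of a deterministic transition function `step` that reads the sequence `q`. -/
def runOn (enter : Q → P) (step : P → Q → P) (q : ℕ → Q) : ℕ → P
  | 0 => enter (q 0)
  | k + 1 => step (runOn enter step q k) (q (k + 1))

/-- This makes the arbitrary continuation in `extendPath` harmless: the run at time `k` sees only
the first `k + 1` entries. -/
theorem runOn_congr {enter : Q → P} {step : P → Q → P} {q q' : ℕ → Q} {k : ℕ}
    (h : ∀ i ≤ k, q i = q' i) : runOn enter step q k = runOn enter step q' k := by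
  induction k with
  | zero => simp [runOn, h 0 le_rfl]
  | succ k ih => simp [runOn, h (k + 1) le_rfl, ih fun i hi => h i (Nat.le_succ_of_le hi)]

/-- The extension of a finite path by repetition of its last state. -/
def extendPath {k : ℕ} (h : Finset.Iic k → S) (i : ℕ) : S :=
  h ⟨min i k, Finset.mem_Iic.2 (min_le_right i k)⟩

theorem extendPath_of_le {k i : ℕ} (h : Finset.Iic k → S) (hi : i ≤ k) :
    extendPath h i = h ⟨i, Finset.mem_Iic.2 hi⟩ := by
  simp [extendPath, hi]

variable [MeasurableSpace S]

theorem measurable_extendPath {k : ℕ} : Measurable (extendPath : (Finset.Iic k → S) → ℕ → S) :=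
  measurable_pi_lambda _ fun _ => measurable_pi_apply _

/-- The partial trajectory from time `0` to time `0` is the identity kernel, so the initial marginal
is a Dirac mass. -/
theorem ae_traj_zero_eq [MeasurableSingletonClass S] {κ : (n : ℕ) → Kernel (Finset.Iic n → S) S}
    [∀ n, IsMarkovKernel (κ n)] (s₀ : S) :
    ∀ᵐ ω ∂Kernel.traj (X := fun _ => S) κ 0 (fun _ => s₀), ω 0 = s₀ := by
  have h := Kernel.traj_map_frestrictLe_apply (X := fun _ => S) (κ := κ) 0 0 (fun _ => s₀)
  rw [Kernel.partialTraj_self, Kernel.id_apply] at h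
  have hd : ∀ᵐ y ∂Measure.dirac (fun _ : Finset.Iic 0 => s₀),
      y ⟨0, Finset.mem_Iic.2 le_rfl⟩ = s₀ := by
    rw [ae_dirac_iff]
    have hm : Measurable fun y : Finset.Iic 0 → S => y ⟨0, Finset.mem_Iic.2 le_rfl⟩ :=
      measurable_pi_apply _
    exact hm (measurableSet_singleton s₀)
  rw [← h] at hd
  exact ae_of_ae_map (Preorder.measurable_frestrictLe 0).aemeasurable hd

variable [Finite P] [Finite Q]

theorem measurable_runOn [MeasurableSpace P] [DiscreteMeasurableSpace P] [MeasurableSpace Q]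
    [DiscreteMeasurableSpace Q] {enter : Q → P} {step : P → Q → P} {abs : S → Q}
    (hκ : Measurable abs) (k : ℕ) :
    Measurable fun ω : ℕ → S => runOn enter step (fun i => abs (ω i)) k := by
  induction k with
  | zero => exact Measurable.comp (g := enter) .of_discrete (hκ.comp (measurable_pi_apply 0))
  | succ k ih =>
    exact Measurable.comp (g := fun p : P × Q => step p.1 p.2) .of_discrete
      (ih.prodMk (hκ.comp (measurable_pi_apply (k + 1))))

theorem integrable_of_measurable_comp_finite {Ω : Type*} [MeasurableSpace Ω] {μ : Measure Ω}
    [IsFiniteMeasure μ] (V : P → ℝ) {f : Ω → P} (hf : Measurable fun ω => V (f ω)) :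
    Integrable (fun ω => V (f ω)) μ := by
  obtain ⟨C, hC⟩ := (Set.finite_range fun p => ‖V p‖).bddAbove
  exact Integrable.of_bound hf.aestronglyMeasurable C (ae_of_all _ fun ω => hC ⟨f ω, rfl⟩)

/-- If `W` is below the conditional expectation of `V` after one step, then the expectation of `W`
at time `k` is below the expectation of `V` at time `k + 1`. -/
theorem integral_runOn_le_succ {κ : (n : ℕ) → Kernel (Finset.Iic n → S) S}
    [∀ n, IsMarkovKernel (κ n)] (x₀ : Finset.Iic 0 → S) {enter : Q → P} {step : P → Q → P}
    {abs : S → Q} (habs : ∀ q, MeasurableSet (abs ⁻¹' {q})) {V W : P → ℝ} {k : ℕ}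
    (h : ∀ x : Finset.Iic k → S,
      W (runOn enter step (fun i => abs (extendPath x i)) k) ≤
        ∫ s, V (step (runOn enter step (fun i => abs (extendPath x i)) k) (abs s)) ∂κ k x) :
    ∫ ω, W (runOn enter step (fun i => abs (ω i)) k) ∂Kernel.traj (X := fun _ => S) κ 0 x₀ ≤
      ∫ ω, V (runOn enter step (fun i => abs (ω i)) (k + 1))
        ∂Kernel.traj (X := fun _ => S) κ 0 x₀ := by
  let _ : MeasurableSpace Q := ⊤
  let _ : MeasurableSpace P := ⊤
  have hκ : Measurable abs := measurable_to_countable' habs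
  let ρ : (Finset.Iic k → S) → P := fun x => runOn enter step (fun i => abs (extendPath x i)) k
  have hρ : Measurable ρ := (measurable_runOn hκ k).comp measurable_extendPath
  have hρω : ∀ ω : ℕ → S, runOn enter step (fun i => abs (ω i)) k =
      ρ (Preorder.frestrictLe (π := fun _ => S) k ω) := fun ω =>
    runOn_congr fun i hi => by rw [extendPath_of_le _ hi]; rfl
  have hF : Measurable fun y : (Finset.Iic k → S) × S => V (step (ρ y.1) (abs y.2)) :=
    Measurable.comp (g := fun p : P × Q => V (step p.1 p.2)) .of_discrete
      ((hρ.comp measurable_fst).prodMk (hκ.comp measurable_snd))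
  have hW : Measurable fun x => W (ρ x) := Measurable.comp (g := W) .of_discrete hρ
  simp only [runOn, hρω]
  exact integral_frestrictLe_le_integral_succ (X := fun _ => S) x₀ hW
    (fun μ _ => integrable_of_measurable_comp_finite W hW) hF
    (fun μ _ => integrable_of_measurable_comp_finite V hF) h

/-- A sequence of functions each of which is below the expectation after one step of its
predecessor. -/
theorem integral_runOn_le {κ : (n : ℕ) → Kernel (Finset.Iic n → S) S}
    [∀ n, IsMarkovKernel (κ n)] (x₀ : Finset.Iic 0 → S) {enter : Q → P} {step : P → Q → P}
    {abs : S → Q} (habs : ∀ q, MeasurableSet (abs ⁻¹' {q})) {V : ℕ → P → ℝ}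
    (h : ∀ n k (x : Finset.Iic k → S),
      V (n + 1) (runOn enter step (fun i => abs (extendPath x i)) k) ≤
        ∫ s, V n (step (runOn enter step (fun i => abs (extendPath x i)) k) (abs s)) ∂κ k x)
    (n k : ℕ) :
    ∫ ω, V n (runOn enter step (fun i => abs (ω i)) k) ∂Kernel.traj (X := fun _ => S) κ 0 x₀ ≤
      ∫ ω, V 0 (runOn enter step (fun i => abs (ω i)) (k + n))
        ∂Kernel.traj (X := fun _ => S) κ 0 x₀ := by
  induction n generalizing k with
  | zero => exact le_rfl
  | succ n ih =>
    have := (integral_runOn_le_succ x₀ habs (h n k)).trans (ih (k + 1))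
    rwa [add_assoc, add_comm 1 n] at this

end Run

theorem integral_comp_eq_sum {Ω Q : Type*} [MeasurableSpace Ω] [Fintype Q] {μ : Measure Ω}
    [IsFiniteMeasure μ] {g : Ω → Q} (hg : ∀ q, MeasurableSet (g ⁻¹' {q})) (f : Q → ℝ) :
    ∫ ω, f (g ω) ∂μ = ∑ q, μ.real (g ⁻¹' {q}) * f q := by
  let _ : MeasurableSpace Q := ⊤
  have hgm : Measurable g := measurable_to_countable' hg
  rw [← integral_map (f := f) hgm.aemeasurable Measurable.of_discrete.aestronglyMeasurable,
    integral_fintype .of_finite]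
  refine Finset.sum_congr rfl fun q _ => ?_
  rw [map_measureReal_apply hgm (measurableSet_singleton q), smul_eq_mul]

/-! ## Nondegeneracy of the transition kernel -/

section Gaussian

open scoped RealInnerProductSpace

/-- A convex null set lies in a hyperplane. -/
theorem Convex.exists_inner_eq_of_volume_eq_zero {m : ℕ} {C : Set (EuclideanSpace ℝ (Fin m))}
    (hC : Convex ℝ C) (h0 : volume C = 0) :
    C = ∅ ∨ ∃ v : EuclideanSpace ℝ (Fin m), v ≠ 0 ∧ ∃ c : ℝ, ∀ y ∈ C, ⟪v, y⟫ = c := by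
  rcases C.eq_empty_or_nonempty with rfl | ⟨p, hp⟩
  · exact Or.inl rfl
  right
  -- A convex set that spans affinely has interior points, hence positive volume. So the span of `C`
  -- is proper, and a nonzero vector orthogonal to its direction is the normal.
  have hspan : affineSpan ℝ C ≠ ⊤ := fun h => by
    have hint := hC.interior_nonempty_iff_affineSpan_eq_top.2 h
    exact (isOpen_interior.measure_pos volume hint).ne'
      (measure_mono_null interior_subset h0)
  have hdir : (affineSpan ℝ C).direction ≠ ⊤ := fun h =>
    hspan ((AffineSubspace.direction_eq_top_iff_of_nonempty
      ⟨p, subset_affineSpan ℝ C hp⟩).1 h)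
  obtain ⟨v, hv, hv0⟩ := Submodule.exists_mem_ne_zero_of_ne_bot
    (mt Submodule.orthogonal_eq_bot_iff.1 hdir)
  refine ⟨v, hv0, ⟪v, p⟫, fun y hy => ?_⟩
  have hmem : y - p ∈ (affineSpan ℝ C).direction :=
    AffineSubspace.vsub_mem_direction (subset_affineSpan ℝ C hy) (subset_affineSpan ℝ C hp)
  have := Submodule.inner_left_of_mem_orthogonal hmem hv
  rw [inner_sub_right] at this
  linarith

variable {A Υ : Type*} {m r : ℕ} [Finite A] [MeasurableSpace A] [DiscreteMeasurableSpace A]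

/-- The functional `⟪u, ·⟫` has a one-dimensional Gaussian law with nonzero variance, which has no
atoms. `S` may be singular; only the direction `u` counts. -/
theorem multivariateGaussian_hyperplane_eq_zero {S : Matrix (Fin r) (Fin r) ℝ}
    (hS : S.PosSemidef) (u : EuclideanSpace ℝ (Fin r)) (hu : u.ofLp ⬝ᵥ S.mulVec u.ofLp ≠ 0)
    (c : ℝ) : multivariateGaussian 0 S {w | ⟪u, w⟫ = c} = 0 := by
  have hset : {w : EuclideanSpace ℝ (Fin r) | ⟪u, w⟫ = c} = innerSL ℝ u ⁻¹' {c} := by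
    ext w; simp
  have hvar : Var[innerSL ℝ u; multivariateGaussian 0 S] = u.ofLp ⬝ᵥ S.mulVec u.ofLp := by
    rw [← covarianceBilin_multivariateGaussian (μ := 0) hS,
      covarianceBilin_self IsGaussian.memLp_two_id]
    rfl
  have hpos : 0 < Var[innerSL ℝ u; multivariateGaussian 0 S] :=
    lt_of_le_of_ne (variance_nonneg _ _) (hvar ▸ hu.symm)
  rw [hset, ← Measure.map_apply (by fun_prop) (measurableSet_singleton c),
    IsGaussian.map_eq_gaussianReal]
  have hne : Var[innerSL ℝ u; multivariateGaussian 0 S].toNNReal ≠ 0 := by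
    simpa [Real.toNNReal_eq_zero] using hpos
  exact gaussianReal_absolutelyContinuous _ hne (by simp)

/-- With nondegenerate noise, the transition kernel does not charge convex Lebesgue null sets. -/
theorem SHS.T_eq_zero_of_volume_eq_zero (H : SHS A Υ m r) {a : A}
    (hG : (H.G a * H.cov * (H.G a).transpose).PosDef) (x : EuclideanSpace ℝ (Fin m))
    {C : Set (EuclideanSpace ℝ (Fin m))} (hC : Convex ℝ C) (h0 : volume C = 0) :
    H.T (a, x) C = 0 := by
  rcases hC.exists_inner_eq_of_volume_eq_zero h0 with rfl | ⟨v, hv0, c, hc⟩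
  · exact measure_empty
  -- Pulling the normal back to the noise space gives a direction whose variance is the quadratic
  -- form of `G cov Gᵀ` at `v`, positive by `hG` even when `cov` is singular.
  let u : EuclideanSpace ℝ (Fin r) := (H.G a).transpose.toEuclideanLin v
  have hadj : ∀ w, ⟪v, (H.G a).toEuclideanLin w⟫ = ⟪u, w⟫ := fun w => by
    simp only [u, EuclideanSpace.inner_eq_star_dotProduct, Matrix.ofLp_toLpLin,
      Matrix.toLin'_apply, star_trivial]
    rw [Matrix.mulVec_transpose, dotProduct_comm, Matrix.dotProduct_mulVec, dotProduct_comm]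
  have hpos : u.ofLp ⬝ᵥ H.cov.mulVec u.ofLp ≠ 0 := by
    have := hG.dotProduct_mulVec_pos (x := v.ofLp) (by simpa using hv0)
    rw [← Matrix.mulVec_mulVec, ← Matrix.mulVec_mulVec, Matrix.dotProduct_mulVec,
      ← Matrix.mulVec_transpose] at this
    simpa [u] using this.ne'
  refine measure_mono_null (t := {y | ⟪v, y⟫ = c}) hc ?_
  have hmeas : MeasurableSet {y : EuclideanSpace ℝ (Fin m) | ⟪v, y⟫ = c} :=
    (isClosed_eq (by fun_prop) continuous_const).measurableSet
  change ((multivariateGaussian 0 H.cov).map fun w => H.next ((a, x), w)) _ = 0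
  rw [Measure.map_apply (f := fun w => H.next ((a, x), w))
    (H.measurable_next.comp measurable_prodMk_left) hmeas]
  have hpre : (fun w => H.next ((a, x), w)) ⁻¹' {y | ⟪v, y⟫ = c} =
      {w | ⟪u, w⟫ = c - ⟪v, (H.F a).toEuclideanLin x⟫} := by
    ext w
    simp only [SHS.next, Set.mem_preimage, Set.mem_ofPred_eq, inner_add_right, hadj]
    constructor <;> intro h <;> linarith
  rw [hpre]
  exact multivariateGaussian_hyperplane_eq_zero H.cov_posSemidef u hpos _

end Gaussian

/-! ## The abstract law of one step -/

section Step

variable {A Υ : Type*} {m r : ℕ} {X : Set (EuclideanSpace ℝ (Fin m))} {Cell : A → Type*}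

theorem Discretization.convex_cell (D : Discretization X Cell) (a : A) (c : Cell a) :
    Convex ℝ (D.cell a c) := by
  obtain ⟨V, hV⟩ := D.polytope a c
  exact hV ▸ convex_convexHull ℝ _

theorem Quantizer.abs_eq_none_iff {D : Discretization X Cell} [MeasurableSpace A]
    (κ : Quantizer D) (s : A × EuclideanSpace ℝ (Fin m)) : κ.abs s = none ↔ s.2 ∉ X := by
  refine ⟨fun h hs => ?_, κ.outside s.1 s.2⟩
  obtain ⟨c, hc, -⟩ := κ.inside s.1 s.2 hs
  rw [Prod.mk.eta] at hc
  rw [hc] at h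
  exact Option.some_ne_none _ h

theorem Quantizer.mem_cell_of_abs_eq {D : Discretization X Cell} [MeasurableSpace A]
    (κ : Quantizer D) {s : A × EuclideanSpace ℝ (Fin m)} {i : Σ a, Cell a}
    (h : κ.abs s = some i) : i.1 = s.1 ∧ s.2 ∈ D.cell i.1 i.2 := by
  have hs : s.2 ∈ X := by
    by_contra hs
    rw [(κ.abs_eq_none_iff s).2 hs] at h
    exact Option.some_ne_none _ h.symm
  obtain ⟨c, hc, hmem⟩ := κ.inside s.1 s.2 hs
  rw [Prod.mk.eta, h] at hc
  cases Option.some_injective _ hc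
  exact ⟨rfl, hmem⟩

variable [Fintype A] [MeasurableSpace A] [DiscreteMeasurableSpace A] [∀ a, Fintype (Cell a)]

/-- The selection on common boundaries costs no probability: a point of the cell assigned elsewhere
lies in another cell of the same mode, and such overlaps are convex null sets. -/
theorem Quantizer.T_real_fiber {H : SHS A Υ m r} {D : Discretization X Cell} (κ : Quantizer D)
    {a : A} (hG : (H.G a * H.cov * (H.G a).transpose).PosDef) (x : EuclideanSpace ℝ (Fin m))
    (c : Cell a) :
    (H.T (a, x)).real {y | κ.abs (a, y) = some ⟨a, c⟩} = (H.T (a, x)).real (D.cell a c) := by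
  refine measureReal_congr (Filter.EventuallyLE.antisymm ?_ ?_)
  · exact LE.le.eventuallyLE fun y hy => (κ.mem_cell_of_abs_eq hy).2
  · rw [ae_le_set]
    refine measure_mono_null
      (t := ⋃ c' : {c' : Cell a // c' ≠ c}, D.cell a c ∩ D.cell a c') ?_ ?_
    · rintro y ⟨hy, hne⟩
      obtain ⟨c', hc', hmem⟩ := κ.inside a y (D.cover a ▸ Set.mem_iUnion.2 ⟨c, hy⟩)
      refine Set.mem_iUnion.2 ⟨⟨c', ?_⟩, hy, hmem⟩
      rintro rfl
      exact hne hc'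
    · exact measure_iUnion_null fun c' => H.T_eq_zero_of_volume_eq_zero hG x
        ((D.convex_cell a c).inter (D.convex_cell a c')) (D.overlap a c c' c'.2.symm)

/-- The law of the abstract state after one step from a point of a cell is feasible. -/
theorem Quantizer.fiberLaw_mem_feasible {H : SHS A Υ m r} (hX : IsCompact X)
    {D : Discretization X Cell} (κ : Quantizer D) {a : A}
    (hG : (H.G a * H.cov * (H.G a).transpose).PosDef) {i : Σ a, Cell a}
    {x : EuclideanSpace ℝ (Fin m)} (hx : x ∈ D.cell i.1 i.2) :
    (fun q => (H.T (a, x)).real ((fun y => κ.abs (a, y)) ⁻¹' {q})) ∈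
      (D.imdp H).feasible (some i) a := by
  have hfib : ∀ q, MeasurableSet ((fun y => κ.abs (a, y)) ⁻¹' {q}) := fun q =>
    measurable_prodMk_left (κ.measurableSet_fiber q)
  have hbb : ∀ B : Set (EuclideanSpace ℝ (Fin m)), BddBelow (Set.range
      fun y : D.cell i.1 i.2 => (H.T (a, (y : EuclideanSpace ℝ (Fin m)))).real B) := fun B =>
    ⟨0, by rintro _ ⟨y, rfl⟩; exact measureReal_nonneg⟩
  have hba : ∀ B : Set (EuclideanSpace ℝ (Fin m)), BddAbove (Set.range
      fun y : D.cell i.1 i.2 => (H.T (a, (y : EuclideanSpace ℝ (Fin m)))).real B) := fun B =>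
    ⟨1, by rintro _ ⟨y, rfl⟩; exact measureReal_le_one⟩
  refine ⟨⟨fun q => measureReal_nonneg, ?_⟩, fun q => ?_⟩
  · have := integral_comp_eq_sum (μ := H.T (a, x)) hfib (fun _ => 1)
    simpa using this.symm
  · rcases q with _ | ⟨b, c⟩
    · have hnone : (fun y => κ.abs (a, y)) ⁻¹' {none} = Xᶜ := by
        ext y
        simp [κ.abs_eq_none_iff]
      simp only [hnone, Discretization.imdp]
      rw [probReal_compl_eq_one_sub hX.measurableSet]
      exact ⟨sub_le_sub_left (le_ciSup (hba X) ⟨x, hx⟩) 1,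
        sub_le_sub_left (ciInf_le (hbb X) ⟨x, hx⟩) 1⟩
    · by_cases hb : b = a
      · subst hb
        simp only [Discretization.imdp, if_true]
        have := κ.T_real_fiber hG x c
        change (H.T (b, x)).real ((fun y => κ.abs (b, y)) ⁻¹' {some ⟨b, c⟩}) = _ at this
        rw [this]
        exact ⟨ciInf_le (hbb _) ⟨x, hx⟩, le_ciSup (hba _) ⟨x, hx⟩⟩
      -- The new mode is the action itself, so cells of other modes are never entered.
      · have hempty : (fun y => κ.abs (a, y)) ⁻¹' {some ⟨b, c⟩} = ∅ := by
          ext y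
          simp only [Set.mem_preimage, Set.mem_singleton_iff, Set.mem_empty_iff_false, iff_false]
          exact fun h => hb (κ.mem_cell_of_abs_eq h).1
        simp [Discretization.imdp, hb, hempty]

open Classical in
/-- The outside is absorbing in the abstraction. -/
theorem Discretization.single_none_mem_feasible (D : Discretization X Cell) (H : SHS A Υ m r)
    (a : A) : (Pi.single none 1 : AbsState Cell → ℝ) ∈ (D.imdp H).feasible none a := by
  refine ⟨single_mem_stdSimplex ℝ none, fun q => ?_⟩
  cases q <;> simp [Discretization.imdp]

theorem SHS.integral_stepKernel (H : SHS A Υ m r) (σ : SwitchingStrategy A m) {k : ℕ}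
    (h : Finset.Iic k → A × EuclideanSpace ℝ (Fin m))
    {f : A × EuclideanSpace ℝ (Fin m) → ℝ} (hf : Measurable f) :
    ∫ s, f s ∂H.stepKernel σ k h =
      ∫ y, f (σ.act k h, y) ∂H.T (σ.act k h, (h ⟨k, Finset.mem_Iic.2 le_rfl⟩).2) := by
  rw [SHS.stepKernel, Kernel.comap_apply, Kernel.prod_apply, Kernel.deterministic_apply,
    Measure.dirac_prod, integral_map (by fun_prop) hf.aestronglyMeasurable]

end Step

/-! ## Runs stopped at acceptance and killed outside -/

section StoppedRun

variable {C M : Type*}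

open Classical in
/-- One step of the product of an abstraction and a memory, stopped in `acc`, where the outside
`none` is made absorbing. -/
noncomputable def stoppedStep (acc : Set M) (δ : M → Option C → M) (s : Option C × M)
    (q : Option C) : Option C × M :=
  if s.2 ∈ acc then s else if s.1 = none then (none, δ s.2 none) else (q, δ s.2 q)

/-- The stopped run from the memory `z₀`. -/
noncomputable def stoppedRun (acc : Set M) (δ : M → Option C → M) (z₀ : M) (q : ℕ → Option C) :
    ℕ → Option C × M :=
  runOn (fun q => (q, δ z₀ q)) (stoppedStep acc δ) q

variable {acc : Set M} {δ : M → Option C → M} {z₀ : M} {q : ℕ → Option C}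

theorem stoppedRun_succ (k : ℕ) : stoppedRun acc δ z₀ q (k + 1) =
    stoppedStep acc δ (stoppedRun acc δ z₀ q k) (q (k + 1)) := rfl

theorem stoppedRun_succ_mem {k : ℕ} (h : (stoppedRun acc δ z₀ q k).2 ∈ acc) :
    (stoppedRun acc δ z₀ q (k + 1)).2 ∈ acc := by
  simp [stoppedRun_succ, stoppedStep, h]

/-- A run that has been neither stopped nor killed is the unrestricted run. -/
theorem stoppedRun_eq {k : ℕ} (h₁ : (stoppedRun acc δ z₀ q k).1 ≠ none)
    (h₂ : (stoppedRun acc δ z₀ q k).2 ∉ acc) :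
    stoppedRun acc δ z₀ q k = (q k, runOn (δ z₀) δ q k) := by
  induction k with
  | zero => rfl
  | succ k ih =>
    have hk : (stoppedRun acc δ z₀ q k).2 ∉ acc := mt stoppedRun_succ_mem h₂
    by_cases hn : (stoppedRun acc δ z₀ q k).1 = none
    · simp [stoppedRun_succ, stoppedStep, hk, hn] at h₁
    · have := ih hn hk
      simp only [stoppedRun_succ, stoppedStep, hk, hn, if_false]
      simp [this, runOn]

/-- If the unrestricted run reaches `acc` inside, then so does the stopped run. -/
theorem stoppedRun_mem_of_runOn_mem {k : ℕ} (hq : ∀ i ≤ k, q i ≠ none)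
    (hk : runOn (δ z₀) δ q k ∈ acc) : (stoppedRun acc δ z₀ q k).2 ∈ acc := by
  by_contra hcon
  -- A stopped state keeps its abstract state and a moving one takes `q (j + 1)`, so neither can be
  -- killed up to time `k`.
  have : ∀ j ≤ k, (stoppedRun acc δ z₀ q j).1 ≠ none := fun j hj => by
    induction j with
    | zero => exact hq 0 hj
    | succ j ih =>
      have hj₁ := ih (by omega)
      by_cases hacc : (stoppedRun acc δ z₀ q j).2 ∈ acc
      · simpa [stoppedRun_succ, stoppedStep, hacc] using hj₁
      · simpa [stoppedRun_succ, stoppedStep, hacc, hj₁] using hq (j + 1) hj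
  rw [stoppedRun_eq (this k le_rfl) hcon] at hcon
  exact hcon hk

/-- If the outside cannot lead to acceptance, then the stopped run reaches `acc` only inside. -/
theorem exists_runOn_mem_of_stoppedRun_mem {R : M → Prop} (hR₀ : ∀ q, R (δ z₀ q))
    (hR : ∀ z q, R z → R (δ z q)) (hnone : ∀ z, R z → z ∉ acc → δ z none ∉ acc)
    (hq₀ : q 0 ≠ none) {k : ℕ} (hk : (stoppedRun acc δ z₀ q k).2 ∈ acc) :
    ∃ j ≤ k, (∀ i ≤ j, q i ≠ none) ∧ runOn (δ z₀) δ q j ∈ acc := by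
  by_contra! hcon
  -- The invariant carries `R` so that `hnone` applies on reading `none`, and the inside history so
  -- that `hcon` applies on entering a cell.
  have key : ∀ j ≤ k, (stoppedRun acc δ z₀ q j).2 ∉ acc ∧ R (stoppedRun acc δ z₀ q j).2 ∧
      ((stoppedRun acc δ z₀ q j).1 ≠ none → ∀ i ≤ j, q i ≠ none) := fun j hj => by
    induction j with
    | zero =>
      have h0 : ∀ i ≤ 0, q i ≠ none := fun i hi => by rwa [Nat.le_zero.1 hi]
      exact ⟨hcon 0 hj h0, hR₀ _, fun _ => h0⟩
    | succ j ih =>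
      obtain ⟨hacc, hRj, hin⟩ := ih (by omega)
      by_cases hn : (stoppedRun acc δ z₀ q j).1 = none
      · have e : stoppedRun acc δ z₀ q (j + 1) = (none, δ (stoppedRun acc δ z₀ q j).2 none) := by
          simp [stoppedRun_succ, stoppedStep, hacc, hn]
        rw [e]
        exact ⟨hnone _ hRj hacc, hR _ _ hRj, fun h => absurd rfl h⟩
      · have e : stoppedRun acc δ z₀ q (j + 1) =
            (q (j + 1), δ (stoppedRun acc δ z₀ q j).2 (q (j + 1))) := by
          simp [stoppedRun_succ, stoppedStep, hacc, hn]
        have hin' : q (j + 1) ≠ none → ∀ i ≤ j + 1, q i ≠ none := fun h i hi => by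
          rcases Nat.le_succ_iff.1 hi with hi | rfl
          exacts [hin hn i hi, h]
        rw [e]
        refine ⟨?_, hR _ _ hRj, hin'⟩
        by_cases hq' : q (j + 1) = none
        · rw [hq']
          exact hnone _ hRj hacc
        · rw [stoppedRun_eq hn hacc]
          exact hcon (j + 1) hj (hin' hq')
  exact (key k le_rfl).1 hk

end StoppedRun

/-! ## Bounds on the probability of acceptance -/

section Bounds

set_option linter.unusedSectionVars false

variable {A Υ M : Type*} {m r : ℕ} {X : Set (EuclideanSpace ℝ (Fin m))} {Cell : A → Type*}
  [Fintype A] [MeasurableSpace A] [DiscreteMeasurableSpace A] [∀ a, Fintype (Cell a)] [Fintype M]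

/-- The abstract states of a path. -/
def Quantizer.absPath {D : Discretization X Cell} (κ : Quantizer D)
    (ω : ℕ → A × EuclideanSpace ℝ (Fin m)) (i : ℕ) : AbsState Cell := κ.abs (ω i)

theorem Quantizer.measurable_comp_abs {D : Discretization X Cell} (κ : Quantizer D)
    (f : AbsState Cell → ℝ) : Measurable fun s => f (κ.abs s) := by
  let _ : MeasurableSpace (AbsState Cell) := ⊤
  exact Measurable.comp (g := f) .of_discrete (measurable_to_countable' κ.measurableSet_fiber)

/-- The stopped run makes feasible steps in the abstraction. -/
theorem Quantizer.exists_feasible_integral_stoppedStep {H : SHS A Υ m r}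
    (hG : ∀ a, (H.G a * H.cov * (H.G a).transpose).PosDef) (hX : IsCompact X)
    {D : Discretization X Cell} (κ : Quantizer D) {acc : Set M} {δ : M → AbsState Cell → M}
    {strat : SwitchingStrategy A m} {k : ℕ} {x : Finset.Iic k → A × EuclideanSpace ℝ (Fin m)}
    {s : AbsState Cell × M} (hs : s.2 ∉ acc)
    (habs : s.1 ≠ none → s.1 = κ.abs (x ⟨k, Finset.mem_Iic.2 le_rfl⟩)) {a : A}
    (ha : s.1 ≠ none → strat.act k x = a) :
    ∃ γ ∈ (D.imdp H).feasible s.1 a, ∀ V : AbsState Cell × M → ℝ,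
      ∫ s', V (stoppedStep acc δ s (κ.abs s')) ∂H.stepKernel strat k x =
        ∑ q, γ q * V (q, δ s.2 q) := by
  classical
  by_cases hn : s.1 = none
  -- A killed run moves deterministically, so the actual mode and position are irrelevant.
  · refine ⟨Pi.single none 1, hn ▸ D.single_none_mem_feasible H a, fun V => ?_⟩
    simp [stoppedStep, hs, hn, Pi.single_apply]
  · obtain ⟨i, hi⟩ := Option.ne_none_iff_exists'.1 hn
    have hx := κ.mem_cell_of_abs_eq ((habs hn).symm.trans hi)
    -- The witness is the true law of the next abstract state from the current continuous state.
    refine ⟨_, hi ▸ κ.fiberLaw_mem_feasible hX (hG a) hx.2, fun V => ?_⟩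
    have hV := κ.measurable_comp_abs fun q => V (stoppedStep acc δ s q)
    have hfib : ∀ q, MeasurableSet ((fun y => κ.abs (a, y)) ⁻¹' {q}) := fun q =>
      measurable_prodMk_left (κ.measurableSet_fiber q)
    rw [H.integral_stepKernel strat x hV, ha hn,
      ← integral_comp_eq_sum hfib (fun q => V (q, δ s.2 q))]
    simp [stoppedStep, hs, hn]

variable {H : SHS A Υ m r} {D : Discretization X Cell} {κ : Quantizer D} {acc : Set M}
  {δ : M → AbsState Cell → M} {z₀ : M} {τ : AbsState Cell × M → A} {strat : SwitchingStrategy A m}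

/-- The strategy `strat` plays `τ` on the unrestricted run of the memory. -/
def Plays (κ : Quantizer D) (δ : M → AbsState Cell → M) (z₀ : M) (τ : AbsState Cell × M → A)
    (strat : SwitchingStrategy A m) : Prop :=
  ∀ k (x : Finset.Iic k → A × EuclideanSpace ℝ (Fin m)),
    strat.act k x = τ (κ.abs (x ⟨k, Finset.mem_Iic.2 le_rfl⟩),
      runOn (δ z₀) δ (κ.absPath (extendPath x)) k)

/-- While neither stopped nor killed, the run is the unrestricted one, so `τ` at its state is the
mode really chosen. After killing the two may differ, but then any action allows the absorbing step.
-/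
theorem Plays.exists_feasible (hplay : Plays κ δ z₀ τ strat)
    (hG : ∀ a, (H.G a * H.cov * (H.G a).transpose).PosDef) (hX : IsCompact X) {k : ℕ}
    (x : Finset.Iic k → A × EuclideanSpace ℝ (Fin m))
    (hs : (stoppedRun acc δ z₀ (κ.absPath (extendPath x)) k).2 ∉ acc) :
    ∃ γ ∈ (D.imdp H).feasible (stoppedRun acc δ z₀ (κ.absPath (extendPath x)) k).1
        (τ (stoppedRun acc δ z₀ (κ.absPath (extendPath x)) k)),
      ∀ V : AbsState Cell × M → ℝ,
        ∫ s', V (stoppedStep acc δ (stoppedRun acc δ z₀ (κ.absPath (extendPath x)) k) (κ.abs s'))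
            ∂H.stepKernel strat k x =
          ∑ q, γ q * V (q, δ (stoppedRun acc δ z₀ (κ.absPath (extendPath x)) k).2 q) := by
  have hlast : κ.absPath (extendPath x) k = κ.abs (x ⟨k, Finset.mem_Iic.2 le_rfl⟩) := by
    rw [Quantizer.absPath, extendPath_of_le x le_rfl]
  refine κ.exists_feasible_integral_stoppedStep hG hX hs (fun hn => ?_) (fun hn => ?_)
  · rw [stoppedRun_eq hn hs, hlast]
  · rw [stoppedRun_eq hn hs, hlast, hplay k x]

/-- The paths whose stopped run has been accepted by time `n`. -/
def acceptedBy (κ : Quantizer D) (acc : Set M) (δ : M → AbsState Cell → M) (z₀ : M) (n : ℕ) :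
    Set (ℕ → A × EuclideanSpace ℝ (Fin m)) :=
  {ω | (stoppedRun acc δ z₀ (κ.absPath ω) n).2 ∈ acc}

theorem integral_bellmanIter_zero (μ : Measure (ℕ → A × EuclideanSpace ℝ (Fin m)))
    (B : (AbsState Cell × M → ℝ) → AbsState Cell × M → ℝ) (n : ℕ) :
    ∫ ω, bellmanIter {s | s.2 ∈ acc} B 0 (stoppedRun acc δ z₀ (κ.absPath ω) n) ∂μ =
      μ.real (acceptedBy κ acc δ z₀ n) := by
  classical
  have hmeas : MeasurableSet (acceptedBy κ acc δ z₀ n) := by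
    let _ : MeasurableSpace (AbsState Cell) := ⊤
    let _ : MeasurableSpace M := ⊤
    have hκ : Measurable κ.abs := measurable_to_countable' κ.measurableSet_fiber
    exact measurable_runOn (P := AbsState Cell × M) hκ n
      (MeasurableSet.of_discrete (s := {s : AbsState Cell × M | s.2 ∈ acc}))
  rw [← integral_indicator_one hmeas]
  refine integral_congr_ae (ae_of_all _ fun ω => ?_)
  by_cases h : ω ∈ acceptedBy κ acc δ z₀ n
  · rw [Set.indicator_of_mem h]
    exact bellmanIter_of_mem (acc := {s : AbsState Cell × M | s.2 ∈ acc}) h 0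
  · rw [Set.indicator_of_notMem h]
    exact if_neg h

/-- At time `0` the memory has already read the initial state, which is the product state at which
the bounds are evaluated. -/
theorem integral_stoppedRun_zero (s₀ : A × EuclideanSpace ℝ (Fin m))
    (V : AbsState Cell × M → ℝ) :
    ∫ ω, V (stoppedRun acc δ z₀ (κ.absPath ω) 0) ∂H.pathMeasure strat s₀ =
      V (κ.abs s₀, δ z₀ (κ.abs s₀)) := by
  have h : ∀ᵐ ω ∂H.pathMeasure strat s₀, ω 0 = s₀ := ae_traj_zero_eq s₀
  have : IsProbabilityMeasure (H.pathMeasure strat s₀) := by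
    unfold SHS.pathMeasure; infer_instance
  rw [integral_congr_ae (g := fun _ => V (κ.abs s₀, δ z₀ (κ.abs s₀)))]
  · simp
  · filter_upwards [h] with ω hω
    simp [stoppedRun, runOn, Quantizer.absPath, hω]

/-- Each step trades one Bellman iteration for one unit of time. In `acc` the run is frozen and all
iterates are `1`; elsewhere the minimum over feasible laws is at most the expectation under the
actual one. After `n` steps the indicator of acceptance is left. -/
theorem bellmanIter_min_le_real_acceptedBy (hplay : Plays κ δ z₀ τ strat)
    (hG : ∀ a, (H.G a * H.cov * (H.G a).transpose).PosDef) (hX : IsCompact X)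
    (s₀ : A × EuclideanSpace ℝ (Fin m)) (n : ℕ) :
    bellmanIter {s | s.2 ∈ acc} (fun V s => ((D.imdp H).prod δ).minExp V s (τ s)) n
        (κ.abs s₀, δ z₀ (κ.abs s₀)) ≤
      (H.pathMeasure strat s₀).real (acceptedBy κ acc δ z₀ n) := by
  set V := bellmanIter {s : AbsState Cell × M | s.2 ∈ acc}
    (fun V s => ((D.imdp H).prod δ).minExp V s (τ s)) with hVdef
  have hV : ∀ n s, V n s ∈ Set.Icc (0 : ℝ) 1 := fun n s =>
    bellmanIter_mem_Icc (fun V hV s => IMDP.minExp_mem_Icc _ hV s (τ s)) n s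
  have hstep : ∀ n k (x : Finset.Iic k → A × EuclideanSpace ℝ (Fin m)),
      V (n + 1) (stoppedRun acc δ z₀ (κ.absPath (extendPath x)) k) ≤
        ∫ s', V n (stoppedStep acc δ (stoppedRun acc δ z₀ (κ.absPath (extendPath x)) k)
          (κ.abs s')) ∂H.stepKernel strat k x := by
    intro n k x
    by_cases hs : (stoppedRun acc δ z₀ (κ.absPath (extendPath x)) k).2 ∈ acc
    · have h1 : ∀ n, V n (stoppedRun acc δ z₀ (κ.absPath (extendPath x)) k) = 1 := fun n =>
        bellmanIter_of_mem (acc := {s : AbsState Cell × M | s.2 ∈ acc}) hs n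
      simp [stoppedStep, hs, h1]
    · obtain ⟨γ, hγ, hint⟩ := hplay.exists_feasible hG hX x hs
      rw [hint, hVdef, bellmanIter_succ_of_notMem
        (acc := {s : AbsState Cell × M | s.2 ∈ acc}) hs]
      exact IMDP.prod_minExp_le _ δ (hV n) hγ _
  have := integral_runOn_le (κ := H.stepKernel strat) (fun _ => s₀) κ.measurableSet_fiber
    (V := V) hstep n 0
  rw [Nat.zero_add] at this
  rw [← integral_stoppedRun_zero (H := H) (strat := strat) (acc := acc) s₀ (V n),
    ← integral_bellmanIter_zero]
  exact this

theorem real_acceptedBy_le_bellmanIter_max (hplay : Plays κ δ z₀ τ strat)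
    (hG : ∀ a, (H.G a * H.cov * (H.G a).transpose).PosDef) (hX : IsCompact X)
    (s₀ : A × EuclideanSpace ℝ (Fin m)) (n : ℕ) :
    (H.pathMeasure strat s₀).real (acceptedBy κ acc δ z₀ n) ≤
      bellmanIter {s | s.2 ∈ acc} (fun V s => ((D.imdp H).prod δ).maxExp V s (τ s)) n
        (κ.abs s₀, δ z₀ (κ.abs s₀)) := by
  set V := bellmanIter {s : AbsState Cell × M | s.2 ∈ acc}
    (fun V s => ((D.imdp H).prod δ).maxExp V s (τ s)) with hVdef
  have hV : ∀ n s, V n s ∈ Set.Icc (0 : ℝ) 1 := fun n s =>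
    bellmanIter_mem_Icc (fun V hV s => IMDP.maxExp_mem_Icc _ hV s (τ s)) n s
  have hstep : ∀ n k (x : Finset.Iic k → A × EuclideanSpace ℝ (Fin m)),
      -- Passing to `-V` turns the reversed inequality into the form of `integral_runOn_le`.
      -V (n + 1) (stoppedRun acc δ z₀ (κ.absPath (extendPath x)) k) ≤
        ∫ s', -V n (stoppedStep acc δ (stoppedRun acc δ z₀ (κ.absPath (extendPath x)) k)
          (κ.abs s')) ∂H.stepKernel strat k x := by
    intro n k x
    rw [integral_neg, neg_le_neg_iff]
    by_cases hs : (stoppedRun acc δ z₀ (κ.absPath (extendPath x)) k).2 ∈ acc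
    · have h1 : ∀ n, V n (stoppedRun acc δ z₀ (κ.absPath (extendPath x)) k) = 1 := fun n =>
        bellmanIter_of_mem (acc := {s : AbsState Cell × M | s.2 ∈ acc}) hs n
      simp [stoppedStep, hs, h1]
    · obtain ⟨γ, hγ, hint⟩ := hplay.exists_feasible hG hX x hs
      rw [hint, hVdef, bellmanIter_succ_of_notMem
        (acc := {s : AbsState Cell × M | s.2 ∈ acc}) hs]
      exact IMDP.le_prod_maxExp _ δ (hV n) hγ _
  have := integral_runOn_le (κ := H.stepKernel strat) (fun _ => s₀) κ.measurableSet_fiber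
    (V := fun n s => -V n s) hstep n 0
  rw [Nat.zero_add, integral_neg, integral_neg, neg_le_neg_iff] at this
  rw [← integral_stoppedRun_zero (H := H) (strat := strat) (acc := acc) s₀ (V n),
    ← integral_bellmanIter_zero]
  exact this

end Bounds

/-! ## The labellings and the automaton -/

section Labels

variable {A Υ Z : Type*} {m r : ℕ} {X : Set (EuclideanSpace ℝ (Fin m))} {Cell : A → Type*}

theorem eval_ofFn_eq_runOn {α Q : Type*} (𝒜 : DFA α Z) (L : Q → α) (q : ℕ → Q) (k : ℕ) :
    𝒜.eval (List.ofFn fun i : Fin (k + 1) => L (q i)) =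
      runOn (fun q => 𝒜.step 𝒜.start (L q)) (fun z q => 𝒜.step z (L q)) q k := by
  induction k with
  | zero => simp [runOn, DFA.eval]
  | succ k ih =>
    rw [List.ofFn_succ', List.concat_eq_append, DFA.eval_append_singleton]
    simpa [runOn] using congrArg (𝒜.step · (L (q (k + 1)))) ih

theorem runOn_prodMk {Q P P' : Type*} {enter : Q → P} {enter' : Q → P'} {step : P → Q → P}
    {step' : P' → Q → P'} (q : ℕ → Q) (k : ℕ) :
    runOn (fun q => (enter q, enter' q)) (fun (z : P × P') q => (step z.1 q, step' z.2 q)) q k =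
      (runOn enter step q k, runOn enter' step' q k) := by
  induction k with
  | zero => rfl
  | succ k ih => simp [runOn, ih]

variable [MeasurableSpace A] {D : Discretization X Cell}

theorem Quantizer.labelUnder_subset (κ : Quantizer D) (H : SHS A Υ m r)
    {s : A × EuclideanSpace ℝ (Fin m)} (hs : s.2 ∈ X) :
    D.labelUnder H (κ.abs s) ⊆ litSet (H.label s) := by
  obtain ⟨c, hc, hmem⟩ := κ.inside s.1 s.2 hs
  rw [Prod.mk.eta] at hc
  rw [hc]
  rintro (p | p) hp
  · exact inl_mem_litSet.2 (hp hmem)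
  · exact inr_mem_litSet.2 (hp hmem).2

/-- The point itself witnesses that its cell meets the region; for a negated literal this uses `hs`,
since that region is a complement within `X`. -/
theorem Quantizer.subset_labelOver (κ : Quantizer D) (H : SHS A Υ m r)
    {s : A × EuclideanSpace ℝ (Fin m)} (hs : s.2 ∈ X) :
    litSet (H.label s) ⊆ D.labelOver H (κ.abs s) := by
  obtain ⟨c, hc, hmem⟩ := κ.inside s.1 s.2 hs
  rw [Prod.mk.eta] at hc
  rw [hc]
  rintro (p | p) hp
  · exact ⟨s.2, hmem, (inl_mem_litSet.1 hp : p ∈ H.label s)⟩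
  · exact ⟨s.2, hmem, hs, (inr_mem_litSet.1 hp : p ∉ H.label s)⟩

variable {φ : Spec Υ} {𝒜 : DFA (Set (Υ ⊕ Υ)) Z}

/-- The complete literal word of the path dominates the accepted word position by position, so
monotonicity transfers the good prefix. -/
theorem isGoodPrefix_of_eval_labelUnder (h𝒜 : ∀ w, w ∈ 𝒜.accepts ↔ φ.IsGoodPrefixBar w)
    (κ : Quantizer D) (H : SHS A Υ m r) {ω : ℕ → A × EuclideanSpace ℝ (Fin m)} {k : ℕ}
    (hω : ∀ i ≤ k, (ω i).2 ∈ X)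
    (h : 𝒜.eval (List.ofFn fun i : Fin (k + 1) => D.labelUnder H (κ.abs (ω i))) ∈ 𝒜.accept) :
    φ.IsGoodPrefix (List.ofFn fun i : Fin (k + 1) => H.label (ω i)) := by
  rw [← φ.isGoodPrefixBar_map_litSet]
  refine ((h𝒜 _).1 h).mono (by simp) fun n h₁ h₂ => ?_
  simp only [List.length_ofFn] at h₁
  simpa [-List.ofFn_succ] using κ.labelUnder_subset H (hω n (by omega))

theorem eval_labelOver_of_isGoodPrefix (h𝒜 : ∀ w, w ∈ 𝒜.accepts ↔ φ.IsGoodPrefixBar w)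
    (κ : Quantizer D) (H : SHS A Υ m r) {ω : ℕ → A × EuclideanSpace ℝ (Fin m)} {k : ℕ}
    (hω : ∀ i ≤ k, (ω i).2 ∈ X)
    (h : φ.IsGoodPrefix (List.ofFn fun i : Fin (k + 1) => H.label (ω i))) :
    𝒜.eval (List.ofFn fun i : Fin (k + 1) => D.labelOver H (κ.abs (ω i))) ∈ 𝒜.accept := by
  rw [← φ.isGoodPrefixBar_map_litSet] at h
  refine (h𝒜 _).2 (h.mono (by simp) fun n h₁ h₂ => ?_)
  simp only [List.length_ofFn] at h₂
  simpa [-List.ofFn_succ] using κ.subset_labelOver H (hω n (by omega))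

end Labels

/-! ### The lower and the upper bound -/

section Main

set_option linter.unusedSectionVars false

variable {A Υ Z : Type*} [Fintype A] [MeasurableSpace A] [DiscreteMeasurableSpace A]
  [Fintype Z] {m r : ℕ} {X : Set (EuclideanSpace ℝ (Fin m))}
  {Cell : A → Type*} [∀ a, Fintype (Cell a)] {D : Discretization X Cell}
  {H : SHS A Υ m r} {φ : Spec Υ} {𝒜 : DFA (Set (Υ ⊕ Υ)) Z}

theorem Quantizer.refine_act (κ : Quantizer D) (σ : AbsState Cell × Z → A)
    (L : AbsState Cell → Set (Υ ⊕ Υ)) (k : ℕ)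
    (x : Finset.Iic k → A × EuclideanSpace ℝ (Fin m)) :
    (κ.refine L 𝒜 σ).act k x = σ (κ.abs (x ⟨k, Finset.mem_Iic.2 le_rfl⟩),
      runOn (fun q => 𝒜.step 𝒜.start (L q)) (fun z q => 𝒜.step z (L q))
        (κ.absPath (extendPath x)) k) := by
  rw [← eval_ofFn_eq_runOn]
  simp only [Quantizer.refine, Quantizer.absPath]
  congr! 5 with i
  rw [extendPath_of_le x (Nat.lt_succ_iff.1 i.2)]

theorem lowerBound_le_satProb (hG : ∀ a, (H.G a * H.cov * (H.G a).transpose).PosDef)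
    (hX : IsCompact X) (κ : Quantizer D) (h𝒜 : ∀ w, w ∈ 𝒜.accepts ↔ φ.IsGoodPrefixBar w)
    {σ : AbsState Cell × Z → A} (hσ : (D.productUnder H 𝒜).IsOptimal (accUnder Cell 𝒜) σ)
    {s₀ : A × EuclideanSpace ℝ (Fin m)} (hs₀ : s₀.2 ∈ X) :
    D.lowerBound H 𝒜 (κ.abs s₀) ≤ H.satProb X φ (κ.refine (D.labelUnder H) 𝒜 σ) s₀ := by
  -- Optimality enters only here: it replaces the maximum over actions by `σ`, after which each
  -- iterate is bounded separately.
  rw [Discretization.lowerBound, ← hσ]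
  refine ciSup_le fun n => ?_
  let δ : Z → AbsState Cell → Z := fun z q => 𝒜.step z (D.labelUnder H q)
  have hplay : Plays κ δ 𝒜.start σ (κ.refine (D.labelUnder H) 𝒜 σ) :=
    fun k x => κ.refine_act σ (D.labelUnder H) k x
  refine (bellmanIter_min_le_real_acceptedBy (acc := 𝒜.accept) hplay hG hX s₀ n).trans ?_
  have hfin : IsProbabilityMeasure
      (H.pathMeasure (κ.refine (D.labelUnder H) 𝒜 σ) s₀) := by
    unfold SHS.pathMeasure; infer_instance
  refine ENNReal.toReal_mono (measure_ne_top _ _) (measure_mono_ae ?_)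
  have h0 : ∀ᵐ ω ∂H.pathMeasure (κ.refine (D.labelUnder H) 𝒜 σ) s₀, ω 0 = s₀ :=
    ae_traj_zero_eq s₀
  filter_upwards [h0] with ω hω hacc
  -- `h𝒜` speaks about words, so the claim is restricted to reachable automaton states.
  have hnone : ∀ z, (∃ w, 𝒜.eval w = z) → z ∉ 𝒜.accept → δ z none ∉ 𝒜.accept := by
    rintro z ⟨w, rfl⟩ hz hz'
    refine hz ((h𝒜 w).2 (Spec.IsGoodPrefixBar.of_append_empty ((h𝒜 _).1 ?_)))
    change 𝒜.eval (w ++ [∅]) ∈ 𝒜.accept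
    rwa [DFA.eval_append_singleton]
  obtain ⟨j, -, hin, hj⟩ := exists_runOn_mem_of_stoppedRun_mem (R := fun z => ∃ w, 𝒜.eval w = z)
    (fun q => ⟨[D.labelUnder H q], by simp [δ, DFA.eval]⟩)
    (by
      rintro z q ⟨w, rfl⟩
      exact ⟨w ++ [D.labelUnder H q], DFA.eval_append_singleton ..⟩) hnone
    (by rw [Quantizer.absPath, hω, Ne, κ.abs_eq_none_iff, not_not]; exact hs₀) hacc
  have hin' : ∀ i ≤ j, (ω i).2 ∈ X := fun i hi => by
    by_contra hi'
    exact hin i hi ((κ.abs_eq_none_iff _).2 hi')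
  refine ⟨j, hin', isGoodPrefix_of_eval_labelUnder h𝒜 κ H hin' ?_⟩
  have := eval_ofFn_eq_runOn 𝒜 (D.labelUnder H) (κ.absPath ω) j
  exact this ▸ hj

theorem satProb_le_upperBound (hG : ∀ a, (H.G a * H.cov * (H.G a).transpose).PosDef)
    (hX : IsCompact X) (κ : Quantizer D) (h𝒜 : ∀ w, w ∈ 𝒜.accepts ↔ φ.IsGoodPrefixBar w)
    (σ : AbsState Cell × Z → A) (s₀ : A × EuclideanSpace ℝ (Fin m)) :
    H.satProb X φ (κ.refine (D.labelUnder H) 𝒜 σ) s₀ ≤ D.upperBound H 𝒜 σ (κ.abs s₀) := by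
  -- The first component drives `σ`, the second decides acceptance.
  let δ : Z × Z → AbsState Cell → Z × Z := fun z q =>
    (𝒜.step z.1 (D.labelUnder H q), 𝒜.step z.2 (D.labelOver H q))
  let acc : Set (Z × Z) := {z | z.2 ∈ 𝒜.accept}
  have hrun : ∀ q k, runOn (δ (𝒜.start, 𝒜.start)) δ q k =
      (runOn (fun q => 𝒜.step 𝒜.start (D.labelUnder H q))
          (fun z q => 𝒜.step z (D.labelUnder H q)) q k,
        runOn (fun q => 𝒜.step 𝒜.start (D.labelOver H q))
          (fun z q => 𝒜.step z (D.labelOver H q)) q k) := fun q k =>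
    runOn_prodMk (step := fun z q => 𝒜.step z (D.labelUnder H q))
      (step' := fun z q => 𝒜.step z (D.labelOver H q)) q k
  have hplay : Plays κ δ (𝒜.start, 𝒜.start) (fun s => σ (s.1, s.2.1))
      (κ.refine (D.labelUnder H) 𝒜 σ) := fun k x => by
    rw [κ.refine_act, hrun]
  set μ := H.pathMeasure (κ.refine (D.labelUnder H) 𝒜 σ) s₀
  have hfin : IsProbabilityMeasure μ := by
    unfold μ SHS.pathMeasure; infer_instance
  have hbound : ∀ n, μ.real (acceptedBy κ acc δ (𝒜.start, 𝒜.start) n) ≤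
      D.upperBound H 𝒜 σ (κ.abs s₀) := fun n => by
    refine (real_acceptedBy_le_bellmanIter_max hplay hG hX s₀ n).trans ?_
    refine le_ciSup (f := fun n => bellmanIter (accOver Cell 𝒜) (fun V s =>
      (D.productOver H 𝒜).maxExp V s (σ (s.1, s.2.1))) n (κ.abs s₀, δ (𝒜.start, 𝒜.start)
        (κ.abs s₀))) ⟨1, ?_⟩ n
    rintro _ ⟨n, rfl⟩
    exact (bellmanIter_mem_Icc (fun V hV s => IMDP.maxExp_mem_Icc _ hV s _) n _).2
  have hsub : H.satEvent X φ ⊆ ⋃ n, acceptedBy κ acc δ (𝒜.start, 𝒜.start) n := by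
    rintro ω ⟨k, hin, hgood⟩
    refine Set.mem_iUnion.2 ⟨k, stoppedRun_mem_of_runOn_mem (fun i hi h => ?_) ?_⟩
    · exact (κ.abs_eq_none_iff _).1 h (hin i hi)
    · rw [hrun]
      change runOn _ _ _ k ∈ 𝒜.accept
      rw [← eval_ofFn_eq_runOn 𝒜 (D.labelOver H)]
      exact eval_labelOver_of_isGoodPrefix h𝒜 κ H hin hgood
  -- Frozen runs stay accepted, so continuity from below reduces the union to the bounds at each
  -- `n`.
  have hmono : Monotone fun n => acceptedBy κ acc δ (𝒜.start, 𝒜.start) n :=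
    monotone_nat_of_le_succ fun n ω hω => stoppedRun_succ_mem hω
  have h0 : 0 ≤ D.upperBound H 𝒜 σ (κ.abs s₀) := measureReal_nonneg.trans (hbound 0)
  refine ENNReal.toReal_le_of_le_ofReal h0 ((measure_mono hsub).trans ?_)
  rw [hmono.measure_iUnion]
  refine iSup_le fun n => ?_
  rw [← ofReal_measureReal]
  exact ENNReal.ofReal_le_ofReal (hbound n)

end Main

theorem mainTheorem2 {A Υ Z : Type*} [Fintype A] [MeasurableSpace A] [DiscreteMeasurableSpace A]
    [Finite Υ] [Fintype Z] {m r : ℕ}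
    (H : SHS A Υ m r) (hG : ∀ a, (H.G a * H.cov * (H.G a).transpose).PosDef)
    (X : Set (EuclideanSpace ℝ (Fin m))) (hX : IsCompact X)
    (hclosed : ∀ p, IsClosed (H.region p)) (hsub : ∀ p, H.region p ⊆ X)
    {Cell : A → Type*} [∀ a, Fintype (Cell a)]
    (D : Discretization X Cell) (κ : Quantizer D)
    (φ : Spec Υ) (𝒜 : DFA (Set (Υ ⊕ Υ)) Z)
    (h𝒜 : ∀ w, w ∈ 𝒜.accepts ↔ φ.IsGoodPrefixBar w)
    (σ : AbsState Cell × Z → A)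
    (hσ : (D.productUnder H 𝒜).IsOptimal (accUnder Cell 𝒜) σ)
    (s₀ : A × EuclideanSpace ℝ (Fin m)) (hs₀ : s₀.2 ∈ X) :
    D.lowerBound H 𝒜 (κ.abs s₀) ≤ H.satProb X φ (κ.refine (D.labelUnder H) 𝒜 σ) s₀ ∧
      H.satProb X φ (κ.refine (D.labelUnder H) 𝒜 σ) s₀ ≤ D.upperBound H 𝒜 σ (κ.abs s₀) :=
  ⟨lowerBound_le_satProb hG hX κ h𝒜 hσ hs₀, satProb_le_upperBound hG hX κ h𝒜 σ s₀⟩
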